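/- Write $\mathbb{R}^*=\coprod_{n\ge 0}\mathbb{R}^n$ for the set of finite tuples of reals. For a set $C\subseteq\mathbb{R}$, a register machine over $(\mathbb{R},+,\times,=)$ with constants from $C$ has data registers $R_0,R_1,\dots$ holding reals and index registers $I_0,I_1,\dots$ holding natural numbers. Its program is a finite list of commands of the following kinds: set $I_j$ to $0$, increment $I_j$, copy $I_i$ to $I_j$, jump if $I_i=I_j$; $R_{I_0}:=R_{I_1}$; $R_0:=R_1+R_2$; $R_0:=R_1\times R_2$; $R_0:=c$ for some $c\in C$; jump if $R_1=R_2$; HALT. On input $(x_1,\dots,x_n)$ the machine starts with $I_0=n$, all other $I_j=0$, $R_i=x_i$ for $1\le i\le n$, and all other $R_i$ equal to a fixed real $a_0$; at HALT the output is $(R_0,\dots,R_{I_0})$. A represented space is a set with a partial surjection from Cantor space $\{0,1\}^{\mathbb{N}}$ onto it. The space $\mathbb{R}$ is represented by sequences of (codes of) rationals $q_i$ with $|x-q_i|<2^{-i}$ for all $i$, the discrete space $\{0,1\}$ by $p\mapsto p(0)$, and finite powers and countable coproducts, in particular $\mathbb{R}^*$, carry the usual representations. A realizer of a multivalued function $f$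 is a partial function on Cantor space that maps each name of each point $x$ of the domain of $f$ to a name of an element of $f(x)$. Write $f\le_W g$ if there are partial functions $K,H$ on Cantor space, computable in the Type-2 sense, such that $p\mapsto K\langle p,G(H(p))\rangle$ is a realizer of $f$ for every realizer $G$ of $g$; write $f\le_W^c g$ if there are such $K,H$ that are continuous on their domains, and $f\equiv_W g$ if $f\le_W g$ and $g\le_W f$. Let $\mathrm{LPO}:\{0,1\}^{\mathbb{N}}\to\{0,1\}$ map $0^\omega$ to $1$ and every other sequence to $0$, and let $\mathrm{LPO}^*$ map $(n;p_1,\dots,p_n)$, for $n\ge 0$, to $(n;\mathrm{LPO}(p_1),\dots,\mathrm{LPO}(p_n))$. **Proposition.** 1. Let $f:\mathbb{R}^*\to\mathbb{R}^*$ be a total function that is computed by a register machine over $(\mathbb{R},+,\times,=)$, where arbitrary real constants and any $a_0\in\mathbb{R}$ are allowed. Then $f\le_W^c\mathrm{LPO}^*$. 2. There is a total function $g:\mathbb{R}^*\to\mathbb{R}^*$ that is computed by a register machine over $(\mathbb{R},+,\times,=)$ without constants and with $a_0=0$, and that satisfies $g\equiv_W\mathrm{LPO}^*$. 3. The function $\mathbb{R}^*\to\mathbb{R}^*$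 that maps $(x_1,\dots,x_n)$ to the one-element tuple whose entry is the number $|\{i\in\{1,\dots,n\} : x_i=0\}|$ is computed by such a machine with $1$ as its only constant and $a_0=0$, and it is Weihrauch equivalent to $\mathrm{LPO}^*$. -/

import Mathlib

namespace AlgWeihrauch

/-! ## Register machines over an algebraic structure -/

/-- An algebraic structure on `A`: partial operations `(Fin k → A) →. A` and relations,
each with its arity. -/
structure AlgStructure (A : Type*) where
  Op : Type
  opArity : Op → ℕ
  op : (o : Op) → (Fin (opArity o) → A) →. A
  Rel : Type
  relArity : Rel → ℕ
  rel : (t : Rel) → (Fin (relArity t) → A) → Prop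

/-- `A^*`, the finite tuples over `A`, of every length `n ≥ 0`. -/
abbrev Tuples (A : Type*) : Type _ := Σ n : ℕ, (Fin n → A)

/-- The commands of a register machine over a structure, with data registers `R i` (in `A`)
and index registers `I j` (in `ℕ`). -/
inductive Command {A : Type*} (S : AlgStructure A) where
  /-- `I j := 0` -/
  | zero (j : ℕ)
  /-- `I j := I j + 1` -/
  | succ (j : ℕ)
  /-- `I j := I i` -/
  | move (i j : ℕ)
  /-- if `I i = I j` go to line `l`, otherwise to the next line -/
  | jumpEq (i j l : ℕ)
  /-- `R (I 0) := R (I 1)` -/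
  | copy
  /-- `R 0 := o (R 1, …, R k)`, where `k` is the arity of `o` -/
  | apply (o : S.Op)
  /-- if `t (R 1, …, R k)` holds go to line `l`, otherwise to the next line -/
  | branch (t : S.Rel) (l : ℕ)
  /-- stop, with output `(R 0, …, R (I 0))` -/
  | halt

/-- Programs are finite lists of commands; lines are numbered from `0`. -/
abbrev Program {A : Type*} (S : AlgStructure A) := List (Command S)

@[ext]
structure Config (A : Type*) where
  line : ℕ
  idx : ℕ → ℕ
  reg : ℕ → A

/-- The start configuration on input `x = (x_1, …, x_n)`: `I 0 = n`, the other index registers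
are `0`, `R i = x_i` for `1 ≤ i ≤ n`, and the other data registers hold `a₀`. -/
def Config.start {A : Type*} (a₀ : A) (x : Tuples A) : Config A where
  line := 0
  idx := fun j => if j = 0 then x.1 else 0
  reg := fun i => if h : 1 ≤ i ∧ i ≤ x.1 then x.2 ⟨i - 1, by omega⟩ else a₀

/-- The tuple `(R 0, …, R (I 0))`. -/
def Config.output {A : Type*} (c : Config A) : Tuples A :=
  ⟨c.idx 0 + 1, fun i => c.reg i⟩

/-- `Step P c c'`: one command of the program `P` leads from `c` to `c'`. There is no next
configuration at `halt`, outside the program, or if an operation is undefined. -/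
def Step {A : Type*} {S : AlgStructure A} (P : Program S) (c c' : Config A) : Prop :=
  match P[c.line]? with
  | some (.zero j) => c' = ⟨c.line + 1, Function.update c.idx j 0, c.reg⟩
  | some (.succ j) => c' = ⟨c.line + 1, Function.update c.idx j (c.idx j + 1), c.reg⟩
  | some (.move i j) => c' = ⟨c.line + 1, Function.update c.idx j (c.idx i), c.reg⟩
  | some (.jumpEq i j l) =>
      c' = ⟨if c.idx i = c.idx j then l else c.line + 1, c.idx, c.reg⟩
  | some .copy => c' = ⟨c.line + 1, c.idx, Function.update c.reg (c.idx 0) (c.reg (c.idx 1))⟩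
  | some (.apply o) => ∃ v ∈ S.op o (fun i => c.reg (i + 1)),
      c' = ⟨c.line + 1, c.idx, Function.update c.reg 0 v⟩
  | some (.branch t l) =>
      (S.rel t (fun i => c.reg (i + 1)) ∧ c' = ⟨l, c.idx, c.reg⟩) ∨
      (¬ S.rel t (fun i => c.reg (i + 1)) ∧ c' = ⟨c.line + 1, c.idx, c.reg⟩)
  | some .halt => False
  | none => False

/-- The program `P`, started on `x`, reaches a `halt` command with output `y`. -/
def HaltsWith {A : Type*} {S : AlgStructure A} (P : Program S) (a₀ : A) (x y : Tuples A) : Prop :=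
  ∃ c : Config A, Relation.ReflTransGen (Step P) (Config.start a₀ x) c ∧
    P[c.line]? = some .halt ∧ c.output = y

/-- A partial function `A^* →. A^*` is computable over the structure `S` if some program
computes it. -/
def MachineComputable {A : Type*} (S : AlgStructure A) (a₀ : A) (g : Tuples A →. Tuples A) : Prop :=
  ∃ P : Program S, ∀ x y, y ∈ g x ↔ HaltsWith P a₀ x y

/-- The operations of the ring of reals with constants from `C`. -/
inductive RingOp (C : Set ℝ) : Type where
  | add
  | mul
  | const (c : C)

def RingOp.arity {C : Set ℝ} : RingOp C → ℕ
  | .add => 2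
  | .mul => 2
  | .const _ => 0

def RingOp.eval {C : Set ℝ} : (o : RingOp C) → (Fin o.arity → ℝ) → ℝ
  | .add, v => v (0 : Fin 2) + v (1 : Fin 2)
  | .mul, v => v (0 : Fin 2) * v (1 : Fin 2)
  | .const c, _ => c

/-- The structure `(ℝ, +, ×, =)` together with the elements of `C` as constants (operations
of arity zero). The only relation is equality. -/
def realRing (C : Set ℝ) : AlgStructure ℝ where
  Op := RingOp C
  opArity := RingOp.arity
  op := fun o v => Part.some (o.eval v)
  Rel := Unit
  relArity := fun _ => 2
  rel := fun _ v => v 0 = v 1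

/-! ## Computability and continuity on Cantor space -/

/-- Cantor space `{0,1}^ℕ`, with the product topology. -/
abbrev Cantor : Type := ℕ → Bool

/-- The finite word `p 0, …, p (n - 1)`. -/
def initialWord (p : Cantor) (n : ℕ) : List Bool := (List.range n).map p

/-- Type-2 computability of a partial function on Cantor space. The word `φ w` is what the
machine has written on its write-once output tape after `w` has been supplied as the
beginning of its input. Nothing is required outside the domain of `F`. -/
def Type2Computable (F : Cantor →. Cantor) : Prop :=
  ∃ φ : List Bool → List Bool, Computable φ ∧ (∀ u v, u <+: v → φ u <+: φ v) ∧
    ∀ p, ∀ q ∈ F p,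
      (∀ m, φ (initialWord p m) = initialWord q (φ (initialWord p m)).length) ∧
      (∀ n, ∃ m, n ≤ (φ (initialWord p m)).length)

/-- Continuity of a partial function, on its domain with the subspace topology. -/
def Type2Continuous (F : Cantor →. Cantor) : Prop :=
  Continuous (fun p : F.Dom => F.fn p.1 p.2)

/-- The pairing `⟨p, q⟩ = p 0, q 0, p 1, q 1, …`. -/
def pairing (p q : Cantor) : Cantor :=
  fun n => if n % 2 = 0 then p (n / 2) else q (n / 2)

/-! ## Represented spaces -/

/-- A represented space: a partial surjection from Cantor space onto `X`, given by its graph;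
`names p x` says that `p` is a name of `x`. -/
class Represented (X : Type*) where
  names : Cantor → X → Prop
  functional : ∀ {p x y}, names p x → names p y → x = y
  surjective : ∀ x, ∃ p, names p x

open Represented (names)

/-- Cantor space is represented by the identity. -/
instance : Represented Cantor where
  names p x := p = x
  functional h h' := h.symm.trans h'
  surjective x := ⟨x, rfl⟩

/-- The discrete space `{0,1}`: the name `p` stands for `p 0`. -/
instance : Represented Bool where
  names p b := p 0 = b
  functional h h' := h.symm.trans h'
  surjective b := ⟨fun _ => b, rfl⟩

/-- The space `ℝ`, part 1: an enumeration of the rationals. -/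
def ratEnum (n : ℕ) : ℚ :=
  ((n.unpair.1.unpair.1 : ℚ) - (n.unpair.1.unpair.2 : ℚ)) / ((n.unpair.2 : ℚ) + 1)

theorem ratEnum_surjective : Function.Surjective ratEnum := by
  intro q
  refine ⟨Nat.pair (Nat.pair q.num.toNat (-q.num).toNat) (q.den - 1), ?_⟩
  have hd : ((q.den - 1 : ℕ) : ℚ) + 1 = q.den := by
    have := q.den_pos
    exact_mod_cast Nat.sub_add_cancel this
  have hn : ((q.num.toNat : ℕ) : ℚ) - ((-q.num).toNat : ℕ) = q.num := by
    have := Int.toNat_sub_toNat_neg q.num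
    exact_mod_cast this
  simp only [ratEnum, Nat.unpair_pair, hd, hn]
  exact q.num_div_den

/-- The position of the `i`-th letter `1` in `0^{s 0} 1 0^{s 1} 1 …`. -/
def onePos (s : ℕ → ℕ) (i : ℕ) : ℕ := (∑ k ∈ Finset.range (i + 1), s k) + i

open Classical in
/-- The sequence `0^{s 0} 1 0^{s 1} 1 0^{s 2} 1 …`. -/
noncomputable def blocks (s : ℕ → ℕ) : Cantor := fun j => decide (∃ i, onePos s i = j)

theorem onePos_strictMono (s : ℕ → ℕ) : StrictMono (onePos s) := by
  refine strictMono_nat_of_lt_succ fun i => ?_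
  simp only [onePos, Finset.sum_range_succ _ (i + 1)]
  omega

theorem blocks_injective : Function.Injective blocks := by
  intro s t h
  have hr : Set.range (onePos s) = Set.range (onePos t) := by
    ext j
    have := congrFun h j
    simpa [blocks] using this
  have ho : onePos s = onePos t :=
    StrictMono.range_inj (onePos_strictMono s) (onePos_strictMono t) |>.1 hr
  funext i
  cases i with
  | zero => simpa [onePos] using congrFun ho 0
  | succ i =>
    have h1 := congrFun ho i
    have h2 := congrFun ho (i + 1)
    simp only [onePos, Finset.sum_range_succ _ (i + 1)] at h1 h2
    omega

/-- The space `ℝ`, part 2: a name of `x` is `0^{s 0} 1 0^{s 1} 1 …` where the `i`-th rational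
`ratEnum (s i)` has distance less than `2^{-i}` from `x`. -/
noncomputable instance : Represented ℝ where
  names p x := ∃ s : ℕ → ℕ, p = blocks s ∧ ∀ i, |x - (ratEnum (s i) : ℝ)| < (1 / 2 : ℝ) ^ i
  functional := by
    rintro p x y ⟨s, rfl, hs⟩ ⟨t, ht, hy⟩
    obtain rfl := blocks_injective ht
    have hlim : Filter.Tendsto (fun i : ℕ => (1 / 2 : ℝ) ^ i) Filter.atTop (nhds 0) :=
      tendsto_pow_atTop_nhds_zero_of_lt_one (by norm_num) (by norm_num)
    have key : ∀ z : ℝ, (∀ i, |z - (ratEnum (s i) : ℝ)| < (1 / 2 : ℝ) ^ i) →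
        Filter.Tendsto (fun i => (ratEnum (s i) : ℝ)) Filter.atTop (nhds z) := by
      intro z hz
      rw [tendsto_iff_dist_tendsto_zero]
      refine squeeze_zero (fun _ => dist_nonneg) (fun i => ?_) hlim
      rw [dist_comm, Real.dist_eq]
      exact (hz i).le
    exact tendsto_nhds_unique (key x hs) (key y hy)
  surjective := by
    intro x
    have : ∀ i : ℕ, ∃ n, |x - (ratEnum n : ℝ)| < (1 / 2 : ℝ) ^ i := by
      intro i
      obtain ⟨q, hq⟩ := (Rat.denseRange_cast (𝕜 := ℝ)).exists_dist_lt x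
        (show (0 : ℝ) < (1 / 2 : ℝ) ^ i by positivity)
      obtain ⟨n, rfl⟩ := ratEnum_surjective q
      exact ⟨n, by simpa [Real.dist_eq] using hq⟩
    choose s hs using this
    exact ⟨blocks s, s, rfl, hs⟩

/-- The finite power `X^n`: a name of a tuple is a sequence of sequences, the `i`-th of which
is a name of the `i`-th entry. -/
instance {X : Type*} [Represented X] (n : ℕ) : Represented (Fin n → X) where
  names p x := ∀ i : Fin n, names (fun k => p (Nat.pair i k)) (x i)
  functional h h' := funext fun i => Represented.functional (h i) (h' i)
  surjective x := by
    choose q hq using fun i => Represented.surjective (x i)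
    refine ⟨fun m => if h : m.unpair.1 < n then q ⟨m.unpair.1, h⟩ m.unpair.2 else false, ?_⟩
    intro i
    have : (fun k => if h : (Nat.pair i k).unpair.1 < n then
        q ⟨(Nat.pair i k).unpair.1, h⟩ (Nat.pair i k).unpair.2 else false) = q i := by
      funext k
      simp
    rw [this]
    exact hq i

/-- The sequence `0^n 1 p`. -/
def tagged (n : ℕ) (p : Cantor) : Cantor :=
  fun j => if j < n then false else if j = n then true else p (j - n - 1)

theorem tagged_injective {m n : ℕ} {p q : Cantor} (h : tagged m p = tagged n q) :
    m = n ∧ p = q := by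
  have hmn : m = n := by
    rcases lt_trichotomy m n with hlt | heq | hgt
    · have := congrFun h m
      simp [tagged, hlt] at this
    · exact heq
    · have := congrFun h n
      simp [tagged, hgt] at this
  subst hmn
  refine ⟨rfl, funext fun k => ?_⟩
  have := congrFun h (m + 1 + k)
  have h1 : ¬ (m + 1 + k < m) := by omega
  have h2 : m + 1 + k ≠ m := by omega
  have h3 : m + 1 + k - m - 1 = k := by omega
  simpa [tagged, h1, h2, h3] using this

/-- The coproduct `∐ n, X n`: a name of `(n, x)` is `0^n 1 p` where `p` is a name of `x`. -/
instance {X : ℕ → Type*} [∀ n, Represented (X n)] : Represented (Σ n, X n) where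
  names r x := ∃ p, r = tagged x.1 p ∧ names p x.2
  functional := by
    rintro r ⟨m, x⟩ ⟨n, y⟩ ⟨p, hp, hx⟩ ⟨q, hq, hy⟩
    obtain ⟨hmn, hpq⟩ := tagged_injective (hp.symm.trans hq)
    dsimp only at hmn
    subst hmn
    subst hpq
    exact congrArg (Sigma.mk m) (Represented.functional hx hy)
  surjective := by
    rintro ⟨n, x⟩
    obtain ⟨p, hp⟩ := Represented.surjective x
    exact ⟨_, p, rfl, hp⟩

/-! ## Weihrauch reducibility -/

/-- A partial multivalued function: `f x` is the set of values, and `x` is in the domain if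
this set is not empty. -/
abbrev MultiFun (X Y : Type*) := X → Set Y

/-- A total single-valued function as a multivalued one. -/
def MultiFun.ofFun {X Y : Type*} (f : X → Y) : MultiFun X Y := fun x => {f x}

section Reducibility

variable {X Y Z W : Type*} [Represented X] [Represented Y] [Represented Z] [Represented W]

/-- `F` is a realizer of `f`: it maps each name of a point of the domain of `f` to a name of
one of the values. -/
def Realizes (F : Cantor →. Cantor) (f : MultiFun X Y) : Prop :=
  ∀ p x, names p x → (f x).Nonempty → ∃ q ∈ F p, ∃ y ∈ f x, names q y

/-- The partial function `K ⟨id, G H⟩`. -/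
def sandwich (K G H : Cantor →. Cantor) : Cantor →. Cantor :=
  fun p => (H p).bind fun q => (G q).bind fun r => K (pairing p r)

/-- Weihrauch reducibility `f ≤_W g`. -/
def WeihrauchLE (f : MultiFun X Y) (g : MultiFun Z W) : Prop :=
  ∃ K H : Cantor →. Cantor, Type2Computable K ∧ Type2Computable H ∧
    ∀ G : Cantor →. Cantor, Realizes G g → Realizes (sandwich K G H) f

/-- Continuous Weihrauch reducibility `f ≤_W^c g`. -/
def ContWeihrauchLE (f : MultiFun X Y) (g : MultiFun Z W) : Prop :=
  ∃ K H : Cantor →. Cantor, Type2Continuous K ∧ Type2Continuous H ∧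
    ∀ G : Cantor →. Cantor, Realizes G g → Realizes (sandwich K G H) f

/-- Weihrauch equivalence `f ≡_W g`. -/
def WeihrauchEquiv (f : MultiFun X Y) (g : MultiFun Z W) : Prop :=
  WeihrauchLE f g ∧ WeihrauchLE g f

end Reducibility

/-- `f^*`, finitely many parallel uses of `f`: the input is a number `n` and an `n`-tuple of
inputs of `f`, the output is a corresponding `n`-tuple of values. -/
def MultiFun.star {X Y : Type*} (f : MultiFun X Y) : MultiFun (Tuples X) (Tuples Y) :=
  fun x => {y | ∃ v : Fin x.1 → Y, y = ⟨x.1, v⟩ ∧ ∀ i, v i ∈ f (x.2 i)}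

open Classical in
/-- `LPO`: the zero sequence is mapped to `1`, all other sequences to `0`. -/
noncomputable def LPO : MultiFun Cantor Bool :=
  MultiFun.ofFun fun p => decide (∀ n, p n = false)

open Classical in
/-- The number of zero entries of a tuple of reals. -/
noncomputable def zeroCount (x : Tuples ℝ) : ℕ :=
  (Finset.univ.filter fun i : Fin x.1 => x.2 i = 0).card

/-- Counting zeros as a function `ℝ^* → ℝ^*`: the value is a tuple of length one. -/
noncomputable def countZeros (x : Tuples ℝ) : Tuples ℝ := ⟨1, fun _ => (zeroCount x : ℝ)⟩

end AlgWeihrauch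

open AlgWeihrauch

namespace AlgWeihrauch

/-! Upper bound. The constants of a program and `a₀` generate a countable subfield `k` of the reals.
On inputs of length `n` the machine can be run symbolically, with polynomials over `k` in the data
registers, and the input matters only through the answers to questions whether a polynomial
vanishes. The crucial point is a uniform time bound on each `ℝ^n` (`exists_uniform_time_bound`). If
there were none, choose for every `t` an input `v t` on which the machine has not halted after `t`
steps. The sequence defines a point of a power of an ultrapower of `ℝ`, and some real point `u`
satisfies exactly the same equations over `k` (`exists_point_with_limit_kernel`). The machine halts
on `u`, say at time `s`; for some `t ≥ s` the run on `v t` agrees with that on `u` up to time `s`, a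
contradiction.

The existence of `u` rests on `exists_generic_near`. The coordinates are treated one at a time: an
algebraic coordinate is a simple root of its minimal polynomial, and simple real roots persist under
perturbation; a transcendental one is replaced by a real number that avoids countably many roots.

With a time bound only finitely many polynomials can ever be tested. One use of `LPO.star` answers
all these tests, and each list of answers selects a continuous output. Subsets of Cantor space are
zero-dimensional, so the continuous real functions involved have continuous realizers.

Lower bound. A sequence of bits is turned into a real that is zero exactly if the sequence is zero.
If the number `c` of zero sequences among finitely many is known, one waits until only `c` of them
have not yet shown a letter `1`; these are the zero sequences (`lpoStar_le_of_finds`). So any output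
from which `c` can be decoded is strong enough: the number itself, or, without constants, a tuple of
zeros of length `c + 1`. Conversely such outputs are computable from the answers of `LPO.star` to
zero tests of the entries. -/

open AlgWeihrauch.Represented (names)

/-! ### Real points with prescribed polynomial equations. -/

open Polynomial in
/-- An algebraic element `a` over the image of `R` has a polynomial `m` with simple root `a` such
that every root of `m` in a real image of `R` with the same kernel satisfies the same equations. -/
theorem exists_controlling_polynomial {R L : Type*} [CommRing R] [Field L] [CharZero L]
    (φ : R →+* L) (a : L) (ha : ∃ p : R[X], p.map φ ≠ 0 ∧ p.eval₂ φ a = 0) :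
    ∃ m : R[X], m.eval₂ φ a = 0 ∧ (derivative m).eval₂ φ a ≠ 0 ∧
      ∀ (ψ : R →+* ℝ) (b : ℝ), (∀ r, φ r = 0 ↔ ψ r = 0) → m.eval₂ ψ b = 0 →
        ∀ F : R[X], F.eval₂ φ a = 0 ↔ F.eval₂ ψ b = 0 := by
  classical
  have hP : (RingHom.ker φ).IsPrime := RingHom.ker_isPrime φ
  set D := R ⧸ RingHom.ker φ
  set K := FractionRing D
  let ρ : R →+* K := (algebraMap D K).comp (Ideal.Quotient.mk _)
  have hφ0 : Function.Injective (RingHom.kerLift φ) := RingHom.kerLift_injective φ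
  let τ : K →+* L := IsFractionRing.lift hφ0
  have hτ : τ.comp ρ = φ := by
    ext r
    simp [τ, ρ, IsFractionRing.lift_algebraMap, D]
  let _ : Algebra K L := τ.toAlgebra
  have haev : ∀ F : R[X], F.eval₂ φ a = aeval a (F.map ρ) := by
    intro F
    rw [aeval_def, eval₂_map]
    change _ = eval₂ (τ.comp ρ) a F
    rw [hτ]
  have hint : IsIntegral K a := by
    obtain ⟨p, hp, hpa⟩ := ha
    refine isAlgebraic_iff_isIntegral.1 ⟨p.map ρ, ?_, ?_⟩
    · intro h
      apply hp
      rw [← hτ, ← Polynomial.map_map, h, Polynomial.map_zero]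
    · rw [← haev, hpa]
  have : CharZero K := (τ.charZero_iff τ.injective).2 inferInstance
  -- The polynomial `m` is the minimal polynomial of `a` over `K` with denominators cleared and
  -- coefficients lifted to `R`; over `K` it differs from the minimal polynomial only by the unit
  -- `c'`.
  obtain ⟨c, hc, hcm⟩ := IsLocalization.integerNormalization_spec (nonZeroDivisors D) (minpoly K a)
  obtain ⟨m, hm⟩ := Polynomial.map_surjective (Ideal.Quotient.mk (RingHom.ker φ))
    Ideal.Quotient.mk_surjective (IsLocalization.integerNormalization (nonZeroDivisors D) (minpoly K a))
  set c' : K := algebraMap D K c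
  have hc' : c' ≠ 0 := by
    simpa [c'] using nonZeroDivisors.ne_zero hc
  have hmρ : m.map ρ = C c' * minpoly K a := by
    rw [← Polynomial.map_map, hm, hcm, ← Polynomial.smul_eq_C_mul, algebraMap_smul]
  have hirr := minpoly.irreducible hint
  refine ⟨m, ?_, ?_, ?_⟩
  · rw [haev, hmρ, map_mul, minpoly.aeval, mul_zero]
  · rw [haev, ← derivative_map, hmρ, derivative_C_mul, map_mul, aeval_C]
    exact mul_ne_zero (by simpa using hc') (hirr.separable.aeval_derivative_ne_zero (minpoly.aeval K a))
  · intro ψ b hk hb F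
    -- Since the kernels agree, `K` embeds into `ℝ` through `ψ` as well, and the equations of `a`
    -- and of `b` can be compared over the same field.
    have hinj : Function.Injective (Ideal.Quotient.lift (RingHom.ker φ) ψ fun r hr => (hk r).1 hr) := by
      rw [injective_iff_map_eq_zero]
      intro x hx
      obtain ⟨r, rfl⟩ := Ideal.Quotient.mk_surjective x
      rw [Ideal.Quotient.lift_mk] at hx
      exact Ideal.Quotient.eq_zero_iff_mem.2 ((hk r).2 hx)
    let σ : K →+* ℝ := IsFractionRing.lift hinj
    have hσ : σ.comp ρ = ψ := by
      ext r
      simp [σ, ρ, IsFractionRing.lift_algebraMap, D]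
    let _ : Algebra K ℝ := σ.toAlgebra
    have hbev : ∀ F : R[X], F.eval₂ ψ b = aeval b (F.map ρ) := by
      intro F
      rw [aeval_def, eval₂_map]
      change _ = eval₂ (σ.comp ρ) b F
      rw [hσ]
    have hroot : aeval b (minpoly K a) = 0 := by
      rw [hbev, hmρ, map_mul, aeval_C] at hb
      exact (mul_eq_zero.1 hb).resolve_left (by simpa using hc')
    have hmin : minpoly K a = minpoly K b :=
      minpoly.eq_of_irreducible_of_monic hirr hroot (minpoly.monic hint)
    rw [haev, hbev, ← minpoly.dvd_iff, ← minpoly.dvd_iff, hmin]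

/-- Near a simple real root, the root persists under small changes of the coefficients. -/
theorem eventually_exists_root_near {T : Type*} [TopologicalSpace T] {F : T → ℝ → ℝ}
    (hF : ∀ x, Continuous fun t => F t x) (hF' : ∀ t, Continuous (F t)) {t₀ : T} {x₀ d : ℝ}
    (h0 : F t₀ x₀ = 0) (hd : HasDerivAt (F t₀) d x₀) (hd0 : d ≠ 0) {ε : ℝ} (hε : 0 < ε) :
    ∀ᶠ t in nhds t₀, ∃ x, |x - x₀| < ε ∧ F t x = 0 := by
  -- For a positive derivative, `F t₀` is negative just left and positive just right of `x₀`. These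
  -- two strict signs survive for nearby `t`, and the intermediate value theorem gives a root. A
  -- negative derivative is reduced to this by passing to `-F`.
  have key : ∀ (F : T → ℝ → ℝ) (d : ℝ), (∀ x, Continuous fun t => F t x) →
      (∀ t, Continuous (F t)) → F t₀ x₀ = 0 → HasDerivAt (F t₀) d x₀ → 0 < d →
      ∀ᶠ t in nhds t₀, ∃ x, |x - x₀| < ε ∧ F t x = 0 := by
    intro F d hF hF' h0 hd hd0
    have hs := hd.tendsto_slope
    have hpos : ∀ᶠ x in nhdsWithin x₀ {x₀}ᶜ, 0 < slope (F t₀) x₀ x :=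
      hs.eventually (lt_mem_nhds hd0)
    rw [eventually_nhdsWithin_iff, Metric.eventually_nhds_iff] at hpos
    obtain ⟨δ, hδ, hpos⟩ := hpos
    set η := min δ ε / 2
    have hη : 0 < η := by positivity
    have hη1 : η < δ := by
      have := min_le_left δ ε
      simp only [η]; linarith
    have hη2 : η < ε := by
      have := min_le_right δ ε
      simp only [η]; linarith
    have hb : 0 < F t₀ (x₀ + η) := by
      have := hpos (y := x₀ + η) (by simpa [Real.dist_eq, abs_of_pos hη]) (by simp [hη.ne'])
      rw [slope_def_field, h0] at this
      simpa [hη] using this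
    have ha : F t₀ (x₀ - η) < 0 := by
      have := hpos (y := x₀ - η) (by simpa [Real.dist_eq, abs_of_pos hη]) (by simp [hη.ne'])
      rw [slope_def_field, h0] at this
      by_contra hcon
      push Not at hcon
      have h2 : (F t₀ (x₀ - η) - 0) / (x₀ - η - x₀) ≤ 0 :=
        div_nonpos_of_nonneg_of_nonpos (by linarith) (by linarith)
      linarith
    filter_upwards [(hF (x₀ + η)).continuousAt.eventually (lt_mem_nhds hb),
      (hF (x₀ - η)).continuousAt.eventually (gt_mem_nhds ha)] with t ht1 ht2
    obtain ⟨x, hx, hx0⟩ := intermediate_value_Icc (by linarith : x₀ - η ≤ x₀ + η)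
      (hF' t).continuousOn ⟨ht2.le, ht1.le⟩
    refine ⟨x, ?_, hx0⟩
    rw [abs_lt]
    constructor <;> linarith [hx.1, hx.2]
  rcases hd0.lt_or_gt with h | h
  · have := key (fun t x => - F t x) (-d) (fun x => (hF x).neg) (fun t => (hF' t).neg)
      (by simp [h0]) hd.neg (by linarith)
    simpa using this
  · exact key F d hF hF' h0 hd h

theorem aeval_cons_eq_eval₂ {k A : Type*} [CommRing k] [CommRing A] [Algebra k A] {n : ℕ}
    (a : A) (w : Fin n → A) (f : MvPolynomial (Fin (n + 1)) k) :
    MvPolynomial.aeval (Fin.cons a w : Fin (n + 1) → A) f =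
      (MvPolynomial.finSuccEquiv k n f).eval₂ (MvPolynomial.aeval w : _ →ₐ[k] A).toRingHom a := by
  induction f using MvPolynomial.induction_on with
  | C c => simp [MvPolynomial.finSuccEquiv_apply]
  | add p q hp hq => simp [hp, hq, Polynomial.eval₂_add]
  | mul_X p i hp =>
    rw [map_mul, map_mul, Polynomial.eval₂_mul, hp, MvPolynomial.aeval_X]
    congr 1
    refine Fin.cases ?_ (fun i => ?_) i
    · simp [MvPolynomial.finSuccEquiv_X_zero]
    · simp [MvPolynomial.finSuccEquiv_X_succ]

theorem aeval_cons_rename_succ {k A : Type*} [CommRing k] [CommRing A] [Algebra k A] {n : ℕ}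
    (a : A) (w : Fin n → A) (f : MvPolynomial (Fin n) k) :
    MvPolynomial.aeval (Fin.cons a w : Fin (n + 1) → A) (MvPolynomial.rename Fin.succ f) =
      MvPolynomial.aeval w f := by
  rw [MvPolynomial.aeval_rename]
  congr 1

theorem aeval_cons_finSuccEquiv_symm {k A : Type*} [CommRing k] [CommRing A] [Algebra k A] {n : ℕ}
    (a : A) (w : Fin n → A) (m : Polynomial (MvPolynomial (Fin n) k)) :
    MvPolynomial.aeval (Fin.cons a w : Fin (n + 1) → A) ((MvPolynomial.finSuccEquiv k n).symm m) =
      m.eval₂ (MvPolynomial.aeval w : _ →ₐ[k] A).toRingHom a := by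
  rw [aeval_cons_eq_eval₂, AlgEquiv.apply_symm_apply]

theorem continuous_aeval_real {k : Type*} [Field k] [Algebra k ℝ] {n : ℕ}
    (f : MvPolynomial (Fin n) k) :
    Continuous fun v : Fin n → ℝ => MvPolynomial.aeval v f := by
  simp only [MvPolynomial.aeval_def, MvPolynomial.eval₂_eq_eval_map]
  exact MvPolynomial.continuous_eval _

/-- The excluded points are the roots of countably many nonzero polynomials, hence a countable set,
and its complement in `ℝ` is dense. -/
theorem dense_avoiding_roots {R : Type*} [CommRing R] [Countable R] (ψ : R →+* ℝ) :
    Dense {x : ℝ | ∀ p : Polynomial R, p.map ψ ≠ 0 → p.eval₂ ψ x ≠ 0} := by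
  have hc : Countable (Polynomial R) := by
    rw [← Cardinal.mk_le_aleph0_iff]
    exact Polynomial.cardinalMk_le_max.trans (max_le (Cardinal.mk_le_aleph0_iff.2 ‹_›) le_rfl)
  have h : (⋃ p ∈ {p : Polynomial R | p.map ψ ≠ 0}, {x : ℝ | p.eval₂ ψ x = 0}).Countable := by
    refine (Set.to_countable _).biUnion fun p hp => Set.Finite.countable ?_
    refine ((p.map ψ).roots.toFinset.finite_toSet).subset fun x hx => ?_
    simpa [Polynomial.eval_map, Polynomial.mem_roots hp] using hx
  refine (h.dense_compl ℝ).mono ?_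
  intro x hx p hp h0
  apply hx
  exact Set.mem_biUnion (show p ∈ {p : Polynomial R | p.map ψ ≠ 0} from hp) h0

/-- Near each real point that satisfies one equation and one inequation valid for `w`, there is a
real point that satisfies exactly the same polynomial equations over `k` as `w`. -/
theorem exists_generic_near {k L : Type*} [Field k] [Countable k] [Algebra k ℝ] [Field L]
    [Algebra k L] [CharZero L] (n : ℕ) (w : Fin n → L) :
    ∃ f g : MvPolynomial (Fin n) k, MvPolynomial.aeval w f = 0 ∧ MvPolynomial.aeval w g ≠ 0 ∧
      ∀ v₀ : Fin n → ℝ, MvPolynomial.aeval v₀ f = 0 → MvPolynomial.aeval v₀ g ≠ 0 →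
        ∀ ε > 0, ∃ v : Fin n → ℝ, (∀ i, |v i - v₀ i| < ε) ∧
          ∀ h : MvPolynomial (Fin n) k, MvPolynomial.aeval w h = 0 ↔ MvPolynomial.aeval v h = 0 := by
  induction n with
  | zero =>
    refine ⟨0, 1, by simp, by simp, fun v₀ _ _ ε _ => ⟨v₀, fun i => i.elim0, fun h => ?_⟩⟩
    obtain ⟨c, rfl⟩ := MvPolynomial.C_surjective (Fin 0) h
    simp
  | succ n ih =>
    obtain ⟨a, w, rfl⟩ : ∃ a w', w = Fin.cons a w' := ⟨w 0, Fin.tail w, (Fin.cons_self_tail w).symm⟩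
    obtain ⟨f, g, hf, hg, ih⟩ := ih w
    have hcR : Countable (MvPolynomial (Fin n) k) := by
      rw [← Cardinal.mk_le_aleph0_iff]
      refine MvPolynomial.cardinalMk_le_max_lift.trans (max_le (max_le ?_ ?_) le_rfl)
      · rw [Cardinal.lift_le_aleph0, Cardinal.mk_le_aleph0_iff]; infer_instance
      · rw [Cardinal.lift_le_aleph0, Cardinal.mk_le_aleph0_iff]; infer_instance
    set φ : MvPolynomial (Fin n) k →+* L := (MvPolynomial.aeval w : _ →ₐ[k] L).toRingHom with hφ
    by_cases halg : ∃ p : Polynomial (MvPolynomial (Fin n) k), p.map φ ≠ 0 ∧ p.eval₂ φ a = 0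
    · obtain ⟨m, hm, hm', hmin⟩ := exists_controlling_polynomial φ a halg
      -- Over the reals a sum of two squares merges two equations into one; the product merges two
      -- inequations, the second of which makes the new coordinate a simple root.
      refine ⟨MvPolynomial.rename Fin.succ f ^ 2 + (MvPolynomial.finSuccEquiv k n).symm m ^ 2,
        MvPolynomial.rename Fin.succ g * (MvPolynomial.finSuccEquiv k n).symm m.derivative, ?_, ?_, ?_⟩
      · rw [map_add, map_pow, map_pow, aeval_cons_rename_succ, aeval_cons_finSuccEquiv_symm, hf, ← hφ, hm]
        simp
      · rw [map_mul, aeval_cons_rename_succ, aeval_cons_finSuccEquiv_symm]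
        exact mul_ne_zero hg hm'
      · intro v₀ hv1 hv2 ε hε
        obtain ⟨b₀, v₀, rfl⟩ : ∃ a w', v₀ = Fin.cons a w' :=
          ⟨v₀ 0, Fin.tail v₀, (Fin.cons_self_tail v₀).symm⟩
        rw [map_add, map_pow, map_pow, aeval_cons_rename_succ, aeval_cons_finSuccEquiv_symm] at hv1
        rw [map_mul, aeval_cons_rename_succ, aeval_cons_finSuccEquiv_symm] at hv2
        obtain ⟨h1, h2⟩ := (add_eq_zero_iff_of_nonneg (sq_nonneg _) (sq_nonneg _)).1 hv1
        rw [sq_eq_zero_iff] at h1 h2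
        have h3 := left_ne_zero_of_mul hv2
        have h4 := right_ne_zero_of_mul hv2
        have hroot := eventually_exists_root_near (T := Fin n → ℝ)
          (F := fun v x => m.eval₂ (MvPolynomial.aeval v : _ →ₐ[k] ℝ).toRingHom x)
          (fun x => by
            simp only [Polynomial.eval₂_eq_sum, Polynomial.sum]
            exact continuous_finsetSum _ fun i _ =>
              (continuous_aeval_real _).mul continuous_const)
          (fun v => by
            simp only [← Polynomial.eval_map]
            exact Polynomial.continuous _)
          (t₀ := v₀) (x₀ := b₀) h2
          (by
            simp only [← Polynomial.eval_map]
            exact Polynomial.hasDerivAt _ _)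
          (by rwa [Polynomial.derivative_map, Polynomial.eval_map]) hε
        rw [Metric.eventually_nhds_iff] at hroot
        obtain ⟨δ, hδ, hroot⟩ := hroot
        -- Here the induction needs points arbitrarily near `v₀`: within `δ` the root `b₀` of the
        -- controlling polynomial at `v₀` moves to a root at `v` that is still within `ε` of `b₀`.
        obtain ⟨v, hv, hvk⟩ := ih v₀ h1 h3 (min δ ε) (by positivity)
        obtain ⟨b, hb, hb0⟩ := hroot (y := v) (by
          rw [dist_pi_lt_iff hδ]
          exact fun i => by simpa [Real.dist_eq] using (hv i).trans_le (min_le_left _ _))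
        refine ⟨Fin.cons b v, Fin.cases (by simpa using hb)
          fun i => by simpa using (hv i).trans_le (min_le_right _ _), fun h => ?_⟩
        rw [aeval_cons_eq_eval₂, aeval_cons_eq_eval₂]
        exact hmin _ b hvk hb0 _
    · push Not at halg
      -- A transcendental coordinate imposes no new condition. Its real counterpart is any nearby
      -- number that is not a root of a nonzero polynomial with coefficients evaluated at `v`.
      refine ⟨MvPolynomial.rename Fin.succ f, MvPolynomial.rename Fin.succ g,
        by rwa [aeval_cons_rename_succ], by rwa [aeval_cons_rename_succ],
        fun v₀ hv1 hv2 ε hε => ?_⟩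
      obtain ⟨b₀, v₀, rfl⟩ : ∃ a w', v₀ = Fin.cons a w' :=
        ⟨v₀ 0, Fin.tail v₀, (Fin.cons_self_tail v₀).symm⟩
      rw [aeval_cons_rename_succ] at hv1 hv2
      obtain ⟨v, hv, hvk⟩ := ih v₀ hv1 hv2 ε hε
      obtain ⟨b, hb, hbε⟩ := (dense_avoiding_roots
        (MvPolynomial.aeval v : _ →ₐ[k] ℝ).toRingHom).exists_dist_lt b₀ hε
      refine ⟨Fin.cons b v, Fin.cases (by simpa [Real.dist_eq, abs_sub_comm] using hbε)
          fun i => by simpa using hv i, fun h => ?_⟩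
      rw [aeval_cons_eq_eval₂, aeval_cons_eq_eval₂]
      set F := MvPolynomial.finSuccEquiv k n h
      have hmap : F.map φ = 0 ↔ F.map (MvPolynomial.aeval v : _ →ₐ[k] ℝ).toRingHom = 0 := by
        simp only [Polynomial.ext_iff, Polynomial.coeff_map, Polynomial.coeff_zero]
        exact forall_congr' fun i => hvk _
      constructor
      · intro h0
        by_contra hne
        have : F.map φ ≠ 0 := fun h =>
          hne (by rw [← Polynomial.eval_map, hmap.1 h, Polynomial.eval_zero])
        exact halg F this h0
      · intro h0
        by_contra hne
        have : F.map (MvPolynomial.aeval v : _ →ₐ[k] ℝ).toRingHom ≠ 0 :=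
          fun h => hne (by rw [← Polynomial.eval_map, hmap.2 h, Polynomial.eval_zero])
        exact hb F this h0

/-- For every sequence of real points, some real point satisfies exactly those equations over `k`
which hold along an ultrafilter. -/
theorem exists_point_with_limit_kernel {k : Subfield ℝ} [Countable k] {n : ℕ}
    (v : ℕ → Fin n → ℝ) :
    ∃ u : Fin n → ℝ, ∀ h : MvPolynomial (Fin n) k, MvPolynomial.aeval u h = 0 ↔
      ∀ᶠ t in (Filter.hyperfilter ℕ : Filter ℕ), MvPolynomial.aeval (v t) h = 0 := by
  -- The diagonal embedding of `ℝ` into its ultrapower, which thereby becomes a field of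
  -- characteristic zero over `k`.
  let ι : ℝ →+* Filter.Germ (Filter.hyperfilter ℕ : Filter ℕ) ℝ :=
    { toFun := fun x => ((fun _ => x : ℕ → ℝ) : Filter.Germ _ ℝ)
      map_one' := rfl
      map_mul' := fun _ _ => rfl
      map_zero' := rfl
      map_add' := fun _ _ => rfl }
  let _ : Algebra k (Filter.Germ (Filter.hyperfilter ℕ : Filter ℕ) ℝ) :=
    (ι.comp (algebraMap k ℝ)).toAlgebra
  have hchar : CharZero (Filter.Germ (Filter.hyperfilter ℕ : Filter ℕ) ℝ) :=
    (ι.charZero_iff ι.injective).1 inferInstance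
  let w : Fin n → Filter.Germ (Filter.hyperfilter ℕ : Filter ℕ) ℝ :=
    fun i => ((fun t => v t i : ℕ → ℝ) : Filter.Germ _ ℝ)
  have hw : ∀ h : MvPolynomial (Fin n) k, MvPolynomial.aeval w h =
      ((fun t => MvPolynomial.aeval (v t) h : ℕ → ℝ) :
        Filter.Germ (Filter.hyperfilter ℕ : Filter ℕ) ℝ) := by
    intro h
    induction h using MvPolynomial.induction_on with
    | C c =>
      simp only [MvPolynomial.algHom_C]
      rfl
    | add p q hp hq =>
      simp only [map_add, hp, hq]
      rfl
    | mul_X p i hp =>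
      simp only [map_mul, hp, MvPolynomial.aeval_X]
      rfl
  have hw0 : ∀ h : MvPolynomial (Fin n) k, MvPolynomial.aeval w h = 0 ↔
      ∀ᶠ t in (Filter.hyperfilter ℕ : Filter ℕ), MvPolynomial.aeval (v t) h = 0 := by
    intro h
    rw [hw]
    exact Filter.Germ.coe_eq
  obtain ⟨f, g, hf, hg, H⟩ := exists_generic_near (k := k) n w
  rw [hw0] at hf
  rw [Ne, hw0, ← Ultrafilter.eventually_not] at hg
  -- The equation and the inequation hold along the ultrafilter, so a single `v t` satisfies both.
  -- It is the real starting point; the distance from it does not matter, whence the arbitrary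
  -- radius `1`.
  obtain ⟨t, ht1, ht2⟩ := (hf.and hg).exists
  obtain ⟨u, -, hu⟩ := H (v t) ht1 ht2 1 one_pos
  exact ⟨u, fun h => by rw [← hu, hw0]⟩

/-! ### Symbolic runs and the uniform time bound. -/

section Symbolic

open Classical in
/-- `c` as an element of the subfield `k`, or `0` if it does not belong to it. -/
noncomputable def toSubfield (k : Subfield ℝ) (c : ℝ) : k := if h : c ∈ k then ⟨c, h⟩ else 0

theorem coe_toSubfield {k : Subfield ℝ} {c : ℝ} (h : c ∈ k) : (toSubfield k c : ℝ) = c := by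
  simp [toSubfield, h]

variable {k : Subfield ℝ} {n : ℕ}

/-- The value of an operation on polynomials in the registers `1, 2`. -/
noncomputable def symOp (k : Subfield ℝ) (n : ℕ) (r : ℕ → MvPolynomial (Fin n) k) :
    RingOp (Set.univ : Set ℝ) → MvPolynomial (Fin n) k
  | .add => r 1 + r 2
  | .mul => r 1 * r 2
  | .const c => MvPolynomial.C (toSubfield k c)

/-- One step on configurations with polynomials in the data registers; `b` is the outcome of
the comparison of `R 1` and `R 2`. -/
noncomputable def symStep (P : Program (realRing Set.univ)) (b : Bool)
    (c : Config (MvPolynomial (Fin n) k)) : Config (MvPolynomial (Fin n) k) :=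
  match P[c.line]? with
  | some (.zero j) => ⟨c.line + 1, Function.update c.idx j 0, c.reg⟩
  | some (.succ j) => ⟨c.line + 1, Function.update c.idx j (c.idx j + 1), c.reg⟩
  | some (.move i j) => ⟨c.line + 1, Function.update c.idx j (c.idx i), c.reg⟩
  | some (.jumpEq i j l) => ⟨if c.idx i = c.idx j then l else c.line + 1, c.idx, c.reg⟩
  | some .copy => ⟨c.line + 1, c.idx, Function.update c.reg (c.idx 0) (c.reg (c.idx 1))⟩
  | some (.apply o) => ⟨c.line + 1, c.idx, Function.update c.reg 0 (symOp k n c.reg o)⟩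
  | some (.branch _ l) => ⟨if b then l else c.line + 1, c.idx, c.reg⟩
  | some .halt => c
  | none => c

noncomputable def evalConfig (v : Fin n → ℝ) (c : Config (MvPolynomial (Fin n) k)) : Config ℝ :=
  ⟨c.line, c.idx, fun i => MvPolynomial.aeval v (c.reg i)⟩

/-- The polynomial on which the next comparison depends. -/
noncomputable def query (c : Config (MvPolynomial (Fin n) k)) : MvPolynomial (Fin n) k :=
  c.reg 1 - c.reg 2

open Classical in
noncomputable def vanishesAt (v : Fin n → ℝ) (p : MvPolynomial (Fin n) k) : Bool :=
  decide (MvPolynomial.aeval v p = 0)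

noncomputable def symStart (k : Subfield ℝ) (n : ℕ) (a₀ : ℝ) : Config (MvPolynomial (Fin n) k) where
  line := 0
  idx := fun j => if j = 0 then n else 0
  reg := fun i => if h : 1 ≤ i ∧ i ≤ n then MvPolynomial.X ⟨i - 1, by omega⟩
    else MvPolynomial.C (toSubfield k a₀)

noncomputable def symRun (k : Subfield ℝ) (n : ℕ) (P : Program (realRing Set.univ)) (a₀ : ℝ)
    (d : MvPolynomial (Fin n) k → Bool) : ℕ → Config (MvPolynomial (Fin n) k)
  | 0 => symStart k n a₀
  | t + 1 => symStep P (d (query (symRun k n P a₀ d t))) (symRun k n P a₀ d t)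

/-- All constants of the program lie in `k`. -/
def ConstantsIn (P : Program (realRing Set.univ)) (k : Subfield ℝ) : Prop :=
  ∀ c, Command.apply (S := realRing Set.univ) (RingOp.const c) ∈ P → (c : ℝ) ∈ k

theorem evalConfig_symStep {P : Program (realRing Set.univ)} (hP : ConstantsIn P k)
    (v : Fin n → ℝ) (c : Config (MvPolynomial (Fin n) k)) {c' : Config ℝ}
    (h : Step P (evalConfig v c) c') :
    c' = evalConfig v (symStep P (vanishesAt v (query c)) c) := by
  have hl : (evalConfig v c).line = c.line := rfl
  have hup : ∀ (r : ℕ → MvPolynomial (Fin n) k) (j : ℕ) (p : MvPolynomial (Fin n) k),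
      Function.update (fun i => MvPolynomial.aeval v (r i)) j (MvPolynomial.aeval v p) =
        fun i => MvPolynomial.aeval v (Function.update r j p i) := by
    intro r j p
    funext i
    by_cases hi : i = j
    · subst hi; simp
    · simp [hi]
  unfold Step at h
  unfold symStep
  rw [hl] at h
  rcases hcmd : P[c.line]? with _ | (j | j | ⟨i, j⟩ | ⟨i, j, l⟩ | _ | o | ⟨t, l⟩ | _) <;>
    rw [hcmd] at h <;> simp only at h ⊢
  · exact h
  · exact h
  · exact h
  · exact h
  · rw [h]; simp only [evalConfig, hup]
  · obtain ⟨x, hx, rfl⟩ := h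
    have hx : x = MvPolynomial.aeval v (symOp k n c.reg o) := by
      rw [show (realRing Set.univ).op o = fun w => Part.some (RingOp.eval o w) from rfl,
        Part.mem_some_iff] at hx
      rw [hx]
      cases o with
      | add => simp [RingOp.eval, symOp, evalConfig]
      | mul => simp [RingOp.eval, symOp, evalConfig]
      | const a =>
        simp only [RingOp.eval, symOp, MvPolynomial.algHom_C]
        exact (coe_toSubfield (hP a (List.mem_of_getElem? hcmd))).symm
    rw [hx]
    simp only [evalConfig, hup]
  · have hrel : (realRing Set.univ).rel t (fun i => (evalConfig v c).reg (i + 1)) ↔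
        vanishesAt v (query c) = true := by
      simp [realRing, evalConfig, vanishesAt, query, sub_eq_zero]
    rw [hrel] at h
    rcases h with ⟨h1, rfl⟩ | ⟨h1, rfl⟩ <;> simp [h1, evalConfig]

theorem evalConfig_symStart {a₀ : ℝ} (ha : a₀ ∈ k) (v : Fin n → ℝ) :
    evalConfig v (symStart k n a₀) = Config.start a₀ ⟨n, v⟩ := by
  ext i
  · rfl
  · rfl
  · simp only [evalConfig, symStart, Config.start]
    split_ifs
    · simp
    · simp only [MvPolynomial.algHom_C]
      exact coe_toSubfield ha

theorem exists_symRun_of_reaches {P : Program (realRing Set.univ)} (hP : ConstantsIn P k) {a₀ : ℝ}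
    (ha : a₀ ∈ k) (v : Fin n → ℝ) {c : Config ℝ}
    (h : Relation.ReflTransGen (Step P) (Config.start a₀ ⟨n, v⟩) c) :
    ∃ t, c = evalConfig v (symRun k n P a₀ (vanishesAt v) t) := by
  induction h with
  | refl => exact ⟨0, (evalConfig_symStart ha v).symm⟩
  | tail _ hs ih =>
    obtain ⟨t, rfl⟩ := ih
    exact ⟨t + 1, evalConfig_symStep hP v _ hs⟩

theorem symRun_eq_of_halted {P : Program (realRing Set.univ)} {a₀ : ℝ}
    {d : MvPolynomial (Fin n) k → Bool} {t s : ℕ} (hts : t ≤ s)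
    (h : P[(symRun k n P a₀ d t).line]? = some .halt) :
    symRun k n P a₀ d s = symRun k n P a₀ d t := by
  induction s, hts using Nat.le_induction with
  | base => rfl
  | succ s _ ih =>
    rw [symRun, ih]
    simp only [symStep, h]

/-- A program that halts on all of `ℝ^n` halts within a bounded number of steps. -/
theorem exists_uniform_time_bound [Countable k] {P : Program (realRing Set.univ)} {a₀ : ℝ}
    (h : ∀ v : Fin n → ℝ, ∃ t, P[(symRun k n P a₀ (vanishesAt v) t).line]? = some .halt) :
    ∃ t, ∀ v : Fin n → ℝ, P[(symRun k n P a₀ (vanishesAt v) t).line]? = some .halt := by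
  by_contra hcon
  push Not at hcon
  choose v hv using hcon
  obtain ⟨u, hu⟩ := exists_point_with_limit_kernel (k := k) v
  have hdec : ∀ p : MvPolynomial (Fin n) k, ∀ᶠ t in (Filter.hyperfilter ℕ : Filter ℕ),
      vanishesAt (v t) p = vanishesAt u p := by
    intro p
    by_cases h0 : MvPolynomial.aeval u p = 0
    · filter_upwards [(hu p).1 h0] with t ht
      simp [vanishesAt, h0, ht]
    · have := mt (hu p).2 h0
      rw [← Ultrafilter.eventually_not] at this
      filter_upwards [this] with t ht
      simp [vanishesAt, h0, ht]
  have hrun : ∀ s, ∀ᶠ t in (Filter.hyperfilter ℕ : Filter ℕ),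
      symRun k n P a₀ (vanishesAt (v t)) s = symRun k n P a₀ (vanishesAt u) s := by
    intro s
    induction s with
    | zero => exact Filter.Eventually.of_forall fun _ => rfl
    | succ s ih =>
      filter_upwards [ih, hdec (query (symRun k n P a₀ (vanishesAt u) s))] with t h1 h2
      rw [symRun, h1, h2, symRun]
  obtain ⟨s, hs⟩ := h u
  -- The ultrafilter is nonprincipal, so the agreement with the run on `u` up to time `s` occurs for
  -- some `t ≥ s`. Then the run on `v t` has halted by time `t`, against the choice of `v t`.
  obtain ⟨t, ht, hst⟩ := ((hrun s).and (Nat.hyperfilter_le_atTop (Filter.eventually_ge_atTop s))).exists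
  rw [← ht] at hs
  exact hv t (by rw [symRun_eq_of_halted hst hs]; exact hs)

/-- For all decision functions together the runs form a binary tree, which has finitely many nodes
at each depth. -/
theorem finite_range_symRun (P : Program (realRing Set.univ)) (a₀ : ℝ) (t : ℕ) :
    (Set.range fun d => symRun k n P a₀ d t).Finite := by
  induction t with
  | zero => exact (Set.finite_singleton (symStart k n a₀)).subset (by rintro _ ⟨d, rfl⟩; rfl)
  | succ t ih =>
    refine (Set.Finite.image2 (symStep P) (Set.finite_univ (α := Bool)) ih).subset ?_
    rintro _ ⟨d, rfl⟩
    exact ⟨_, Set.mem_univ _, _, ⟨d, rfl⟩, rfl⟩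

/-- Only the answers to queries actually met along the run matter; this permits replacing the true
zero test by a finite table. -/
theorem symRun_congr {P : Program (realRing Set.univ)} {a₀ : ℝ}
    {d d' : MvPolynomial (Fin n) k → Bool} {t : ℕ}
    (h : ∀ s < t, d (query (symRun k n P a₀ d s)) = d' (query (symRun k n P a₀ d s))) :
    symRun k n P a₀ d t = symRun k n P a₀ d' t := by
  induction t with
  | zero => rfl
  | succ t ih =>
    rw [symRun, symRun, ← ih fun s hs => h s (by omega), h t (by omega)]

end Symbolic

/-! ### From machines to finitely many continuous pieces. -/

/-- On every power of `ℝ`, the function is given by finitely many continuous pieces, which are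
selected by the outcomes of finitely many tests for zero of continuous functions. -/
def ContinuousPieces (f : Tuples ℝ → Tuples ℝ) : Prop :=
  ∀ n, ∃ (N : ℕ) (Q : Fin N → (Fin n → ℝ) → ℝ) (len : (Fin N → Bool) → ℕ)
    (O : ∀ b, (Fin n → ℝ) → Fin (len b) → ℝ), (∀ i, Continuous (Q i)) ∧ (∀ b, Continuous (O b)) ∧
      ∀ (x : Fin n → ℝ) (b : Fin N → Bool), (∀ i, b i = true ↔ Q i x = 0) →
        f ⟨n, x⟩ = ⟨len b, O b x⟩

theorem continuousPieces_of_machineComputable {a₀ : ℝ} {f : Tuples ℝ → Tuples ℝ}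
    (hf : MachineComputable (realRing Set.univ) a₀ (f : Tuples ℝ →. Tuples ℝ)) :
    ContinuousPieces f := by
  classical
  obtain ⟨P, hP⟩ := hf
  have hhalt : ∀ x, HaltsWith P a₀ x (f x) := fun x => (hP x (f x)).1 (by simp)
  -- Commands that carry no constant contribute `0`, which lies in every subfield anyway.
  set S : Set ℝ := insert a₀ ((fun c => match c with
    | Command.apply (RingOp.const c) => (c : ℝ)
    | _ => (0 : ℝ)) '' {c : Command (realRing Set.univ) | c ∈ P})
  have hS : S.Countable := by
    refine Set.Countable.insert _ (Set.Countable.image ?_ _)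
    exact (List.finite_toSet P).countable
  let k : Subfield ℝ := Subfield.closure S
  have hk : Countable k := by
    rw [← Cardinal.mk_le_aleph0_iff]
    exact (Subfield.cardinalMk_closure_le_max S).trans (max_le hS.le_aleph0 le_rfl)
  have ha : a₀ ∈ k := Subfield.subset_closure (Set.mem_insert _ _)
  have hconst : ConstantsIn P k := fun c hc =>
    Subfield.subset_closure (Set.mem_insert_of_mem _ ⟨_, hc, rfl⟩)
  intro n
  have hrun : ∀ v : Fin n → ℝ, ∃ t, P[(symRun k n P a₀ (vanishesAt v) t).line]? = some .halt ∧
      (evalConfig v (symRun k n P a₀ (vanishesAt v) t)).output = f ⟨n, v⟩ := by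
    intro v
    obtain ⟨c, hc, hh, ho⟩ := hhalt ⟨n, v⟩
    obtain ⟨t, rfl⟩ := exists_symRun_of_reaches hconst ha v hc
    exact ⟨t, hh, ho⟩
  obtain ⟨T, hT⟩ := exists_uniform_time_bound fun v => (hrun v).imp fun t ht => ht.1
  have hout : ∀ v : Fin n → ℝ,
      (evalConfig v (symRun k n P a₀ (vanishesAt v) T)).output = f ⟨n, v⟩ := by
    intro v
    obtain ⟨t, ht, ho⟩ := hrun v
    rw [← ho]
    rcases le_total t T with h | h
    · rw [symRun_eq_of_halted h ht]
    · rw [symRun_eq_of_halted h (hT v)]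
  -- All queries that any answers could lead to before time `T`, in particular those of all actual
  -- inputs. They become the tests `Q`.
  have hfin : (⋃ s ∈ Set.Iio T, query '' Set.range fun d => symRun k n P a₀ d s).Finite :=
    (Set.finite_Iio T).biUnion fun s _ => (finite_range_symRun P a₀ s).image _
  set G := hfin.toFinset
  let dec : (Fin G.card → Bool) → MvPolynomial (Fin n) k → Bool := fun b p =>
    if h : p ∈ G then b (G.equivFin ⟨p, h⟩) else false
  refine ⟨G.card, fun i x => MvPolynomial.aeval x (G.equivFin.symm i : MvPolynomial (Fin n) k),
    fun b => (symRun k n P a₀ (dec b) T).idx 0 + 1,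
    fun b x i => MvPolynomial.aeval x ((symRun k n P a₀ (dec b) T).reg i),
    fun i => continuous_aeval_real _, fun b => continuous_pi fun i => continuous_aeval_real _, ?_⟩
  intro x b hb
  have : symRun k n P a₀ (vanishesAt x) T = symRun k n P a₀ (dec b) T := by
    refine symRun_congr fun s hs => ?_
    set p := query (symRun k n P a₀ (vanishesAt x) s)
    have hp : p ∈ G := by
      rw [Set.Finite.mem_toFinset]
      exact Set.mem_biUnion (show s ∈ Set.Iio T from hs) ⟨_, ⟨_, rfl⟩, rfl⟩
    have := hb (G.equivFin ⟨p, hp⟩)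
    simp only [Equiv.symm_apply_apply] at this
    rw [Bool.eq_iff_iff]
    simp only [dec, hp, dif_pos, this, vanishesAt, decide_eq_true_iff]
  rw [← hout x, this]
  rfl

/-! ### Reading the unary block code. -/

section Scan

/-- The number of letters `1` in a word, and the length of the block of letters `0` at its end. -/
def scan (u : List Bool) : ℕ × ℕ :=
  u.foldl (fun a b => if b then (a.1 + 1, 0) else (a.1, a.2 + 1)) (0, 0)

theorem initialWord_succ (p : Cantor) (n : ℕ) :
    initialWord p (n + 1) = initialWord p n ++ [p n] := by
  simp [initialWord, List.range_succ]

@[simp]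
theorem length_initialWord (p : Cantor) (n : ℕ) : (initialWord p n).length = n := by
  simp [initialWord]

theorem initialWord_congr {p q : Cantor} {n : ℕ} (h : ∀ i < n, p i = q i) :
    initialWord p n = initialWord q n := by
  simp only [initialWord]
  exact List.map_congr_left fun i hi => h i (List.mem_range.1 hi)

theorem scan_append_singleton (u : List Bool) (b : Bool) :
    scan (u ++ [b]) = if b then ((scan u).1 + 1, 0) else ((scan u).1, (scan u).2 + 1) := by
  simp [scan]

/-- The position at which the `j`-th block begins. -/
def blockStart (s : ℕ → ℕ) (j : ℕ) : ℕ := (∑ k ∈ Finset.range j, s k) + j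

theorem onePos_eq (s : ℕ → ℕ) (j : ℕ) : onePos s j = blockStart s j + s j := by
  simp only [onePos, blockStart, Finset.sum_range_succ]
  omega

theorem blockStart_succ (s : ℕ → ℕ) (j : ℕ) : blockStart s (j + 1) = blockStart s j + s j + 1 := by
  simp only [blockStart, Finset.sum_range_succ]
  omega

theorem exists_block (s : ℕ → ℕ) (N : ℕ) : ∃ j t, t ≤ s j ∧ N = blockStart s j + t := by
  induction N with
  | zero => exact ⟨0, 0, Nat.zero_le _, by simp [blockStart]⟩
  | succ N ih =>
    obtain ⟨j, t, ht, rfl⟩ := ih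
    rcases ht.lt_or_eq with h | rfl
    · exact ⟨j, t + 1, h, rfl⟩
    · exact ⟨j + 1, 0, Nat.zero_le _, by rw [blockStart_succ]⟩

theorem blockStart_monotone (s : ℕ → ℕ) : Monotone (blockStart s) :=
  monotone_nat_of_le_succ fun j => by rw [blockStart_succ]; omega

theorem blocks_apply {s : ℕ → ℕ} {j t : ℕ} (ht : t ≤ s j) :
    blocks s (blockStart s j + t) = decide (t = s j) := by
  simp only [blocks, decide_eq_decide]
  constructor
  · rintro ⟨i, hi⟩
    rw [onePos_eq] at hi
    rcases lt_trichotomy i j with h | rfl | h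
    · have := blockStart_monotone s (show i + 1 ≤ j from h)
      rw [blockStart_succ] at this
      omega
    · omega
    · have := blockStart_monotone s (show j + 1 ≤ i from h)
      rw [blockStart_succ] at this
      omega
  · rintro rfl
    exact ⟨j, onePos_eq s j⟩

theorem scan_initialWord_blocks {s : ℕ → ℕ} {j t : ℕ} (ht : t ≤ s j) :
    scan (initialWord (blocks s) (blockStart s j + t)) = (j, t) := by
  suffices ∀ N j t, t ≤ s j → N = blockStart s j + t → scan (initialWord (blocks s) N) = (j, t) from
    this _ j t ht rfl
  intro N
  induction N with
  | zero =>
    intro j t ht h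
    simp only [blockStart] at h
    obtain rfl : j = 0 := by omega
    obtain rfl : t = 0 := by omega
    rfl
  | succ N ih =>
    intro j t ht h
    rw [initialWord_succ, scan_append_singleton]
    rcases t with _ | t
    · rcases j with _ | j
      · simp [blockStart] at h
      · rw [blockStart_succ] at h
        have hN : N = blockStart s j + s j := by omega
        rw [ih j (s j) le_rfl hN, hN, blocks_apply le_rfl]
        simp
    · have hN : N = blockStart s j + t := by omega
      rw [ih j t (by omega) hN, hN, blocks_apply (by omega)]
      have : t ≠ s j := by omega
      simp [this]

/-- After the same word the scanner is in the same state for both sequences, and both have the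
letter `1` next; so the `j`-th block ends there in both. -/
theorem eq_of_blocks_agree {s s' : ℕ → ℕ} {j : ℕ}
    (h : ∀ i ≤ onePos s j, blocks s' i = blocks s i) : s' j = s j := by
  have h1 := scan_initialWord_blocks (le_refl (s j))
  rw [← onePos_eq] at h1
  obtain ⟨j', t', ht', hN⟩ := exists_block s' (onePos s j)
  have h2 := scan_initialWord_blocks ht'
  rw [← hN, initialWord_congr fun i hi => h i hi.le, h1] at h2
  have h3 := h _ le_rfl
  rw [hN, blocks_apply ht', ← hN, onePos_eq, blocks_apply le_rfl] at h3
  simp only [Prod.mk.injEq] at h2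
  obtain ⟨rfl, rfl⟩ := h2
  simpa [eq_comm] using h3

end Scan

/-! ### Zero-dimensionality and continuous realizers. -/

theorem abs_sub_lt_of_names_agree {p p' : Cantor} {x x' : ℝ} {s : ℕ → ℕ} (hs : p = blocks s)
    (hx : ∀ i, |x - (ratEnum (s i) : ℝ)| < (1 / 2 : ℝ) ^ i) (hp' : names p' x') {j : ℕ}
    (h : ∀ i ≤ onePos s j, p' i = p i) : |x' - x| < 2 * (1 / 2 : ℝ) ^ j := by
  obtain ⟨s', rfl, hx'⟩ := hp'
  subst hs
  have := hx' j
  rw [eq_of_blocks_agree h] at this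
  have h2 := hx j
  rw [abs_lt] at *
  constructor <;> linarith [this.1, this.2, h2.1, h2.2]

theorem eventually_agree (p : Cantor) (M : ℕ) : ∀ᶠ p' in nhds p, ∀ i < M, p' i = p i := by
  have : ∀ i ∈ Finset.range M, ∀ᶠ p' in nhds p, p' i = p i := fun i _ => by
    have : ContinuousAt (fun q : Cantor => q i) p := (continuous_apply i).continuousAt
    rwa [ContinuousAt, nhds_discrete Bool, Filter.tendsto_pure] at this
  filter_upwards [(Filter.eventually_all_finset _).2 this] with p' hp' i hi
  exact hp' i (Finset.mem_range.2 hi)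

theorem exists_agree_of_mem_nhds {p : Cantor} {U : Set Cantor} (hU : U ∈ nhds p) :
    ∃ M, ∀ p', (∀ i < M, p' i = p i) → p' ∈ U := by
  rw [nhds_pi, Filter.mem_pi] at hU
  obtain ⟨I, hI, t, ht, htU⟩ := hU
  obtain ⟨M, hM⟩ := hI.bddAbove
  refine ⟨M + 1, fun p' hp' => htU fun i hi => ?_⟩
  rw [hp' i (Nat.lt_succ_of_le (hM hi))]
  exact mem_of_mem_nhds (ht i)

/-- A subset of Cantor space is zero-dimensional: a relatively open cover has a locally constant
choice function. -/
theorem exists_locally_constant_choice {D : Set Cantor} {U : ℕ → Set Cantor}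
    (hU : ∀ p ∈ D, ∃ c, U c ∈ nhdsWithin p D) :
    ∃ s : Cantor → ℕ, ∀ p ∈ D, p ∈ U (s p) ∧ ∀ᶠ p' in nhds p, s p' = s p := by
  classical
  let cyl : ℕ → Cantor → Set Cantor := fun m p => {p' | p' ∈ D ∧ ∀ i < m, p' i = p i}
  have hex : ∀ p ∈ D, ∃ m c, cyl m p ⊆ U c := by
    intro p hp
    obtain ⟨c, hc⟩ := hU p hp
    rw [mem_nhdsWithin_iff_exists_mem_nhds_inter] at hc
    obtain ⟨V, hV, hVU⟩ := hc
    obtain ⟨M, hM⟩ := exists_agree_of_mem_nhds hV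
    exact ⟨M, c, fun p' hp' => hVU ⟨hM p' hp'.2, hp'.1⟩⟩
  have hcyl : ∀ {m M p p'}, m ≤ M → (∀ i < M, p' i = p i) → cyl m p' = cyl m p := by
    intro m M p p' hm h
    ext r
    refine and_congr_right fun _ => forall₂_congr fun i hi => ?_
    rw [h i (by omega)]
  -- Take the shortest cylinder around `p` that fits into some `U c`, and then the least such `c`.
  -- Every point of that cylinder leads to the same cylinder and hence to the same choice.
  let s : Cantor → ℕ := fun p =>
    if h : ∃ m c, cyl m p ⊆ U c then Nat.find (Nat.find_spec h) else 0
  refine ⟨s, fun p hp => ?_⟩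
  have h := hex p hp
  constructor
  · simp only [s, h, dif_pos]
    exact Nat.find_spec (Nat.find_spec h) ⟨hp, fun _ _ => rfl⟩
  · filter_upwards [eventually_agree p (Nat.find h)] with p' hp'
    have h' : ∃ m c, cyl m p' ⊆ U c :=
      ⟨Nat.find h, by rw [hcyl le_rfl hp']; exact Nat.find_spec h⟩
    have hm : Nat.find h' = Nat.find h := by
      rw [Nat.find_eq_iff]
      refine ⟨by rw [hcyl le_rfl hp']; exact Nat.find_spec h, fun m hm => ?_⟩
      rw [hcyl hm.le hp']
      exact Nat.find_min h hm
    simp only [s, h, h', dif_pos]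
    rw [Nat.find_eq_iff]
    refine ⟨?_, fun m hmlt => ?_⟩
    · have := Nat.find_spec (Nat.find_spec h)
      rwa [hm, hcyl le_rfl hp']
    · rw [hm, hcyl le_rfl hp']
      exact Nat.find_min (Nat.find_spec h) hmlt

theorem exists_ratEnum_near (x : ℝ) {ε : ℝ} (hε : 0 < ε) : ∃ n, |x - (ratEnum n : ℝ)| < ε := by
  obtain ⟨q, hq⟩ := (Rat.denseRange_cast (𝕜 := ℝ)).exists_dist_lt x hε
  obtain ⟨n, rfl⟩ := ratEnum_surjective q
  exact ⟨n, by simpa [Real.dist_eq] using hq⟩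

/-- A continuous real function on a subset of Cantor space has locally constant approximations. -/
theorem exists_locally_constant_codes {D : Set Cantor} {F : Cantor → ℝ} (hF : ContinuousOn F D) :
    ∃ s : ℕ → Cantor → ℕ, ∀ i, ∀ p ∈ D, |F p - (ratEnum (s i p) : ℝ)| < (1 / 2 : ℝ) ^ i ∧
      ∀ᶠ p' in nhds p, s i p' = s i p := by
  have : ∀ i : ℕ, ∃ s : Cantor → ℕ, ∀ p ∈ D, |F p - (ratEnum (s p) : ℝ)| < (1 / 2 : ℝ) ^ i ∧
      ∀ᶠ p' in nhds p, s p' = s p := by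
    intro i
    refine exists_locally_constant_choice
      (U := fun c => {p | |F p - (ratEnum c : ℝ)| < (1 / 2 : ℝ) ^ i}) fun p hp => ?_
    obtain ⟨c, hc⟩ := exists_ratEnum_near (F p) (show (0 : ℝ) < (1 / 2 : ℝ) ^ i by positivity)
    have hcont : ContinuousWithinAt (fun p => |F p - (ratEnum c : ℝ)|) D p :=
      ((hF p hp).sub continuousWithinAt_const).abs
    exact ⟨c, hcont.eventually (gt_mem_nhds hc)⟩
  choose s hs using this
  exact ⟨s, hs⟩

theorem blocks_congr {s s' : ℕ → ℕ} {j : ℕ} (h : ∀ i ≤ j, s' i = s i) : blocks s' j = blocks s j := by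
  simp only [blocks, decide_eq_decide]
  refine exists_congr fun i => ?_
  by_cases hi : i ≤ j
  · have : onePos s' i = onePos s i := by
      simp only [onePos]
      rw [Finset.sum_congr rfl fun k hk => h k (by have := Finset.mem_range.1 hk; omega)]
    rw [this]
  · simp only [onePos]
    omega

theorem continuousOn_cantor_of_eventually {D : Set Cantor} {q : Cantor → Cantor}
    (h : ∀ j, ∀ p ∈ D, ∀ᶠ p' in nhdsWithin p D, q p' j = q p j) : ContinuousOn q D := by
  refine continuousOn_pi.2 fun j p hp => ?_
  rw [ContinuousWithinAt, nhds_discrete, Filter.tendsto_pure]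
  exact h j p hp

theorem ContinuousOn.eventually_apply_eq {D : Set Cantor} {q : Cantor → Cantor}
    (h : ContinuousOn q D) (j : ℕ) {p : Cantor} (hp : p ∈ D) :
    ∀ᶠ p' in nhdsWithin p D, q p' j = q p j := by
  have := (continuousOn_pi.1 h j) p hp
  rwa [ContinuousWithinAt, nhds_discrete, Filter.tendsto_pure] at this

theorem exists_continuousOn_name {D : Set Cantor} {F : Cantor → ℝ} (hF : ContinuousOn F D) :
    ∃ q : Cantor → Cantor, ContinuousOn q D ∧ ∀ p ∈ D, names (q p) (F p) := by
  obtain ⟨s, hs⟩ := exists_locally_constant_codes hF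
  refine ⟨fun p => blocks fun i => s i p, continuousOn_cantor_of_eventually fun j p hp => ?_,
    fun p hp => ⟨_, rfl, fun i => (hs i p hp).1⟩⟩
  have : ∀ᶠ p' in nhds p, ∀ i ∈ Finset.range (j + 1), s i p' = s i p :=
    (Filter.eventually_all_finset _).2 fun i _ => (hs i p hp).2
  filter_upwards [nhdsWithin_le_nhds this] with p' hp'
  exact blocks_congr fun i hi => hp' i (Finset.mem_range.2 (by omega))

/-- If all `q i` are that small, then `|x| < 2 * (1 / 2) ^ i` for every `i`. Thus `x ≠ 0` is
recognised from a single approximation by a comparison of rationals. -/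
theorem eq_zero_iff_forall_abs_lt {x : ℝ} {q : ℕ → ℚ} (h : ∀ i, |x - (q i : ℝ)| < (1 / 2 : ℝ) ^ i) :
    x = 0 ↔ ∀ i, |q i| < (1 / 2 : ℚ) ^ i := by
  have hcast : ∀ i, |q i| < (1 / 2 : ℚ) ^ i ↔ |(q i : ℝ)| < (1 / 2 : ℝ) ^ i := by
    intro i
    rw [← Rat.cast_abs, ← Rat.cast_lt (K := ℝ)]
    push_cast
    rfl
  simp only [hcast]
  constructor
  · rintro rfl i
    simpa using h i
  · intro hq
    by_contra hx
    have hpos : 0 < |x| / 2 := by positivity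
    obtain ⟨i, hi⟩ := exists_pow_lt_of_lt_one hpos (by norm_num : (1 / 2 : ℝ) < 1)
    have h1 := h i
    have h2 := hq i
    have h3 : |x| ≤ |x - (q i : ℝ)| + |(q i : ℝ)| := by
      simpa using abs_add_le (x - (q i : ℝ)) (q i : ℝ)
    linarith

theorem exists_continuousOn_zero_test {D : Set Cantor} {F : Cantor → ℝ} (hF : ContinuousOn F D) :
    ∃ z : Cantor → Cantor, ContinuousOn z D ∧ ∀ p ∈ D, (∀ j, z p j = false) ↔ F p = 0 := by
  obtain ⟨s, hs⟩ := exists_locally_constant_codes hF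
  refine ⟨fun p j => decide (¬ |ratEnum (s j p)| < (1 / 2 : ℚ) ^ j),
    continuousOn_cantor_of_eventually fun j p hp => ?_, fun p hp => ?_⟩
  · filter_upwards [nhdsWithin_le_nhds (hs j p hp).2] with p' hp'
    simp only [hp']
  · rw [eq_zero_iff_forall_abs_lt fun i => (hs i p hp).1]
    simp

/-- Gluing along a locally constant label. -/
theorem continuousOn_of_label {α : Type*} {D : Set Cantor} {lab : Cantor → α}
    (hlab : ∀ p ∈ D, ∀ᶠ p' in nhdsWithin p D, lab p' = lab p) {h : α → Cantor → Cantor}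
    (hh : ∀ a, ContinuousOn (h a) {p | p ∈ D ∧ lab p = a}) :
    ContinuousOn (fun p => h (lab p) p) D := by
  refine continuousOn_cantor_of_eventually fun j p hp => ?_
  have h1 := ContinuousOn.eventually_apply_eq (hh (lab p)) j (p := p) ⟨hp, rfl⟩
  rw [eventually_nhdsWithin_iff] at h1
  filter_upwards [hlab p hp, nhdsWithin_le_nhds h1, self_mem_nhdsWithin] with p' h2 h3 h4
  rw [h2]
  exact h3 ⟨h4, h2⟩

/-- The joint name of a tuple of length `n`, made of names of its entries. -/
def joinTuple (n : ℕ) (q : Fin n → Cantor) : Cantor :=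
  tagged n fun m => if h : m.unpair.1 < n then q ⟨m.unpair.1, h⟩ m.unpair.2 else false

theorem names_joinTuple {X : Type*} [Represented X] {n : ℕ} {q : Fin n → Cantor} {x : Fin n → X}
    (h : ∀ i, names (q i) (x i)) : names (joinTuple n q) (⟨n, x⟩ : Tuples X) := by
  refine ⟨_, rfl, fun i => ?_⟩
  convert h i using 1
  funext k
  simp

theorem continuousOn_joinTuple {D : Set Cantor} {n : ℕ} {q : Fin n → Cantor → Cantor}
    (h : ∀ i, ContinuousOn (q i) D) : ContinuousOn (fun p => joinTuple n fun i => q i p) D := by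
  refine continuousOn_cantor_of_eventually fun j p hp => ?_
  simp only [joinTuple, tagged]
  by_cases h1 : j < n
  · simp [h1]
  by_cases h2 : j = n
  · simp [h2]
  by_cases h3 : (j - n - 1).unpair.1 < n
  · filter_upwards [ContinuousOn.eventually_apply_eq (h ⟨_, h3⟩) (j - n - 1).unpair.2 hp] with p' hp'
    simp [h1, h2, h3, hp']
  · simp [h1, h2, h3]

open Classical in
/-- The real tuple with the given name. -/
noncomputable def realTuple (p : Cantor) : Tuples ℝ :=
  if h : ∃ x : Tuples ℝ, names p x then h.choose else ⟨0, fun i => i.elim0⟩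

theorem realTuple_eq {p : Cantor} {x : Tuples ℝ} (h : names p x) : realTuple p = x := by
  have hex : ∃ x : Tuples ℝ, names p x := ⟨x, h⟩
  rw [realTuple, dif_pos hex]
  exact Represented.functional hex.choose_spec h

/-- The `i`-th entry of the real tuple with the given name. -/
noncomputable def realEntry (p : Cantor) (i : ℕ) : ℝ :=
  if h : i < (realTuple p).1 then (realTuple p).2 ⟨i, h⟩ else 0

theorem realEntry_eq {p : Cantor} {n : ℕ} {x : Fin n → ℝ} (h : names p (⟨n, x⟩ : Tuples ℝ)) (i : Fin n) :
    realEntry p i = x i := by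
  have := realTuple_eq h
  unfold realEntry
  rw [this]
  simp

def realTupleNames : Set Cantor := {p | ∃ x : Tuples ℝ, names p x}

theorem tagged_apply_self (n : ℕ) (p : Cantor) : tagged n p n = true := by simp [tagged]

theorem tagged_apply_of_lt {n j : ℕ} (p : Cantor) (h : j < n) : tagged n p j = false := by
  simp [tagged, h]

theorem tagged_apply_add (n k : ℕ) (p : Cantor) : tagged n p (n + 1 + k) = p k := by
  have h1 : ¬ (n + 1 + k < n) := by omega
  have h2 : n + 1 + k ≠ n := by omega
  have h3 : n + 1 + k - n - 1 = k := by omega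
  simp [tagged, h1, h2, h3]

theorem tag_eq_of_agree {n n' : ℕ} {p p' : Cantor}
    (h : ∀ i < n + 1, tagged n' p' i = tagged n p i) : n' = n := by
  rcases lt_trichotomy n' n with hlt | heq | hgt
  · have := h n' (by omega)
    rw [tagged_apply_self, tagged_apply_of_lt _ hlt] at this
    simp at this
  · exact heq
  · have := h n (by omega)
    rw [tagged_apply_self, tagged_apply_of_lt _ hgt] at this
    simp at this

theorem eventually_length_eq {p : Cantor} (hp : p ∈ realTupleNames) :
    ∀ᶠ p' in nhdsWithin p realTupleNames, (realTuple p').1 = (realTuple p).1 := by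
  obtain ⟨x, hx⟩ := hp
  rw [realTuple_eq hx]
  obtain ⟨r, hr, -⟩ := hx
  filter_upwards [nhdsWithin_le_nhds (eventually_agree p (x.1 + 1)), self_mem_nhdsWithin] with p' h1 h2
  obtain ⟨x', hx'⟩ := h2
  rw [realTuple_eq hx']
  obtain ⟨r', hr', -⟩ := hx'
  rw [hr, hr'] at h1
  exact tag_eq_of_agree h1

/-- A long enough common beginning of two names fixes the `j`-th rational of the `i`-th entry, and
both entries are within `2^{-j}` of it. -/
theorem continuousOn_realEntry (n : ℕ) (i : Fin n) :
    ContinuousOn (fun p => realEntry p i) {p | p ∈ realTupleNames ∧ (realTuple p).1 = n} := by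
  have hex : ∀ p, p ∈ realTupleNames ∧ (realTuple p).1 = n →
      ∃ x : Fin n → ℝ, names p (⟨n, x⟩ : Tuples ℝ) := by
    rintro p ⟨⟨⟨m, x⟩, hx⟩, hn⟩
    rw [realTuple_eq hx] at hn
    dsimp only at hn
    subst hn
    exact ⟨x, hx⟩
  intro p hp
  obtain ⟨x, hx⟩ := hex p hp
  rw [ContinuousWithinAt, realEntry_eq hx i, Metric.tendsto_nhds]
  intro ε hε
  obtain ⟨r, hr, hrx⟩ := hx
  obtain ⟨s, hs, hsx⟩ := hrx i
  obtain ⟨j, hj⟩ := exists_pow_lt_of_lt_one (show 0 < ε / 2 by positivity)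
    (by norm_num : (1 / 2 : ℝ) < 1)
  filter_upwards [nhdsWithin_le_nhds (eventually_agree p (n + 1 + Nat.pair i (onePos s j) + 1)),
    self_mem_nhdsWithin] with p' h1 h2
  obtain ⟨x', hx'⟩ := hex p' h2
  rw [realEntry_eq hx' i, Real.dist_eq]
  obtain ⟨r', hr', hrx'⟩ := hx'
  have := abs_sub_lt_of_names_agree hs hsx (hrx' i) (j := j) (by
    intro a ha
    have hle : Nat.pair i a ≤ Nat.pair i (onePos s j) :=
      ha.lt_or_eq.elim (fun h => (Nat.pair_lt_pair_right _ h).le) fun h => by rw [h]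
    have := h1 (n + 1 + Nat.pair i a) (by omega)
    rw [hr, hr'] at this
    dsimp only at this
    rwa [tagged_apply_add, tagged_apply_add] at this)
  linarith

/-! ### The continuous reduction to `LPO.star`. -/

section Reductions

theorem realizes_sandwich {X Y Z W : Type*} [Represented X] [Represented Y] [Represented Z]
    [Represented W] {f : X → Y} {g : Z → W} {K H : Cantor →. Cantor}
    (h : ∀ p x, names p x → ∃ q ∈ H p, ∃ z, names q z ∧
      ∀ r, names r (g z) → ∃ s ∈ K (pairing p r), names s (f x)) (G : Cantor →. Cantor)
    (hG : Realizes G (MultiFun.ofFun g)) : Realizes (sandwich K G H) (MultiFun.ofFun f) := by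
  intro p x hp _
  obtain ⟨q, hq, z, hz, hK⟩ := h p x hp
  obtain ⟨r, hr, y, rfl, hry⟩ := hG q z hz ⟨_, rfl⟩
  obtain ⟨s, hs, hsx⟩ := hK r hry
  exact ⟨s, Part.mem_bind hq (Part.mem_bind hr hs), _, rfl, hsx⟩

open Classical in
/-- The function with graph `LPO.star`. -/
noncomputable def lpoStar (z : Tuples Cantor) : Tuples Bool :=
  ⟨z.1, fun i => decide (∀ n, z.2 i n = false)⟩

theorem LPO_star_eq : LPO.star = MultiFun.ofFun lpoStar := by
  classical
  funext z
  ext y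
  simp only [MultiFun.star, LPO, MultiFun.ofFun, Set.mem_ofPred_eq, Set.mem_singleton_iff, lpoStar]
  constructor
  · rintro ⟨v, rfl, hv⟩
    congr 1
    funext i
    rw [hv i]
  · rintro rfl
    exact ⟨_, rfl, fun i => rfl⟩

theorem evens_pairing (p r : Cantor) : (fun k => pairing p r (2 * k)) = p := by
  funext k
  simp [pairing]

theorem odds_pairing (p r : Cantor) : (fun k => pairing p r (2 * k + 1)) = r := by
  funext k
  have h1 : (2 * k + 1) % 2 ≠ 0 := by omega
  have h2 : (2 * k + 1) / 2 = k := by omega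
  simp [pairing, h2]

theorem contWeihrauchLE_of_continuousPieces {f : Tuples ℝ → Tuples ℝ} (hf : ContinuousPieces f) :
    ContWeihrauchLE (MultiFun.ofFun f) LPO.star := by
  choose N Q len O hQ hO hfe using hf
  have hentries : ∀ n, ContinuousOn (fun p => fun i : Fin n => realEntry p i)
      {p | p ∈ realTupleNames ∧ (realTuple p).1 = n} := fun n =>
    continuousOn_pi.2 fun i => continuousOn_realEntry n i
  have hz : ∀ n i, ∃ z : Cantor → Cantor,
      ContinuousOn z {p | p ∈ realTupleNames ∧ (realTuple p).1 = n} ∧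
      ∀ p, p ∈ realTupleNames ∧ (realTuple p).1 = n →
        ((∀ j, z p j = false) ↔ Q n i (fun i => realEntry p i) = 0) := fun n i =>
    exists_continuousOn_zero_test ((hQ n i).comp_continuousOn (hentries n))
  choose z hzc hz using hz
  let ev : Cantor → Cantor := fun u k => u (2 * k)
  have hev : Continuous ev := continuous_pi fun k => continuous_apply _
  have hev' : ∀ (S : Set Cantor), Set.MapsTo ev (ev ⁻¹' S) S := fun S => Set.mapsTo_preimage _ _
  have hy : ∀ n b i, ∃ q : Cantor → Cantor,
      ContinuousOn q (ev ⁻¹' {p | p ∈ realTupleNames ∧ (realTuple p).1 = n}) ∧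
      ∀ u ∈ ev ⁻¹' {p | p ∈ realTupleNames ∧ (realTuple p).1 = n},
        names (q u) (O n b (fun i => realEntry (ev u) i) i) := fun n b i =>
    exists_continuousOn_name (((continuous_apply i).comp (hO n b)).comp_continuousOn
      ((hentries n).comp hev.continuousOn (hev' _)))
  choose q hqc hq using hy
  -- The input length and the table of answers. The answer bit `i` is the first letter of the `i`-th
  -- component of the answer, which the pairing puts at odd positions behind the tag.
  let label : Cantor → Σ n, (Fin (N n) → Bool) := fun u =>
    ⟨(realTuple (ev u)).1, fun i => u (2 * (N (realTuple (ev u)).1 + 1 + Nat.pair i 0) + 1)⟩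
  let h : Cantor → Cantor := fun p =>
    joinTuple (N (realTuple p).1) fun i => z (realTuple p).1 i p
  let k : Cantor → Cantor := fun u =>
    joinTuple (len (label u).1 (label u).2) fun i => q (label u).1 (label u).2 i u
  have hh : ContinuousOn h realTupleNames :=
    continuousOn_of_label (lab := fun p => (realTuple p).1) (fun p hp => eventually_length_eq hp)
      (h := fun n p => joinTuple (N n) fun i => z n i p)
      fun n => continuousOn_joinTuple fun i => hzc n i
  have hk : ContinuousOn k (ev ⁻¹' realTupleNames) := by
    refine continuousOn_of_label (lab := label) (fun u hu => ?_)
      (h := fun a u => joinTuple (len a.1 a.2) fun i => q a.1 a.2 i u) ?_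
    · have h1 := (hev.continuousWithinAt.tendsto_nhdsWithin (hev' realTupleNames)).eventually
        (eventually_length_eq hu)
      -- The pairing function increases in its first argument, so this length covers every position
      -- that the label reads.
      filter_upwards [h1, nhdsWithin_le_nhds (eventually_agree u
        (2 * (N (realTuple (ev u)).1 + 1 + Nat.pair (N (realTuple (ev u)).1) 0) + 2))] with u' h1 h2
      simp only [label]
      rw [h1]
      congr 1
      funext i
      refine h2 _ ?_
      have := Nat.pair_lt_pair_left 0 i.2
      omega
    · rintro ⟨n, b⟩
      refine continuousOn_joinTuple fun i => (hqc n b i).mono ?_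
      rintro u ⟨hu1, hu2⟩
      exact ⟨hu1, congrArg Sigma.fst hu2⟩
  rw [LPO_star_eq]
  refine ⟨fun u => ⟨u ∈ ev ⁻¹' realTupleNames, fun _ => k u⟩,
    fun p => ⟨p ∈ realTupleNames, fun _ => h p⟩, continuousOn_iff_continuous_domRestrict.1 hk,
    continuousOn_iff_continuous_domRestrict.1 hh, fun G hG => realizes_sandwich ?_ G hG⟩
  rintro p ⟨n, x⟩ hp
  have hpD : p ∈ realTupleNames := ⟨_, hp⟩
  have hlen : (realTuple p).1 = n := by rw [realTuple_eq hp]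
  have hx : (fun i : Fin n => realEntry p i) = x := funext fun i => realEntry_eq hp i
  refine ⟨h p, ⟨hpD, rfl⟩, ⟨N n, fun i => z n i p⟩, ?_, ?_⟩
  · have : h p = joinTuple (N n) fun i => z n i p := by
      simp only [h]
      rw [hlen]
    rw [this]
    exact names_joinTuple fun i => rfl
  · rintro r ⟨r', hr, hr'⟩
    have hevp : ev (pairing p r) = p := evens_pairing p r
    have hodp := odds_pairing p r
    dsimp only [lpoStar] at hr hr'
    set b : Fin (N n) → Bool := fun i => r' (Nat.pair i 0) with hb
    have hlab : label (pairing p r) = ⟨n, b⟩ := by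
      simp only [label]
      rw [hevp, hlen]
      congr 1
      funext i
      rw [congrFun hodp (N n + 1 + Nat.pair i 0), hr, tagged_apply_add]
    have hku : k (pairing p r) =
        joinTuple (len n b) fun i => q n b i (pairing p r) := by
      simp only [k]
      rw [hlab]
    have hmem : pairing p r ∈ ev ⁻¹' {p | p ∈ realTupleNames ∧ (realTuple p).1 = n} := by
      rw [Set.mem_preimage, hevp]
      exact ⟨hpD, hlen⟩
    have hfx : f ⟨n, x⟩ = ⟨len n b, O n b x⟩ := by
      refine hfe n x b fun i => ?_
      have h1 : b i = _ := hr' i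
      have h2 := hz n i p ⟨hpD, hlen⟩
      rw [hx] at h2
      rw [h1, ← h2]
      exact @decide_eq_true_iff _ (Classical.propDecidable _)
    refine ⟨k (pairing p r), ⟨hmem.1, rfl⟩, ?_⟩
    rw [hku, hfx]
    refine names_joinTuple fun i => ?_
    have := hq n b i _ hmem
    rwa [hevp, hx] at this

end Reductions

/-! ### Two ways of producing Type-2 computable functions. -/

section Type2

theorem take_initialWord (p : Cantor) {j m : ℕ} (h : j ≤ m) :
    (initialWord p m).take j = initialWord p j := by
  simp [initialWord, ← List.map_take, List.take_range, h]

theorem getD_initialWord (p : Cantor) {j m : ℕ} (h : j < m) :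
    (initialWord p m).getD j false = p j := by
  simp [initialWord, List.getD_eq_getElem?_getD, h]

/-- The function whose `j`-th output letter is computed from the first `j + 1` input letters. -/
def causal (h : List Bool → Bool) (p : Cantor) : Cantor := fun j => h (initialWord p (j + 1))

theorem type2Computable_causal {h : List Bool → Bool} (hh : Primrec h) :
    Type2Computable (fun p => Part.some (causal h p)) := by
  refine ⟨fun w => (List.range w.length).map fun j => h (w.take (j + 1)), ?_, ?_, ?_⟩
  · refine (Primrec.list_map (Primrec.list_range.comp Primrec.list_length) ?_).to_comp
    exact hh.comp (Primrec.list_take.comp (Primrec.succ.comp Primrec.snd) Primrec.fst)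
  · rintro u v ⟨t, rfl⟩
    rw [List.prefix_iff_eq_take]
    simp only [List.length_map, List.length_range, List.length_append, ← List.map_take,
      List.take_range]
    rw [Nat.min_eq_left (by omega)]
    refine List.map_congr_left fun j hj => ?_
    rw [List.take_append_of_le_length (by simpa using hj)]
  · intro p q hq
    rw [Part.mem_some_iff] at hq
    subst hq
    refine ⟨fun m => ?_, fun n => ⟨n, by simp⟩⟩
    simp only [List.length_map, List.length_range, length_initialWord]
    refine List.map_congr_left fun j hj => ?_
    rw [take_initialWord p (by simpa using hj), causal]

/-- The first value that `ψ` has on an initial segment of the word. -/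
def firstValue (ψ : List Bool → ℕ → Option Bool) (w : List Bool) (j : ℕ) : Option Bool :=
  ((List.range (w.length + 1)).filterMap fun m => ψ (w.take m) j).head?

/-- Outside the domain `ψ` may contradict itself on longer words, whereas the output word must grow
monotonically on all inputs. The first value found is never revised. -/
theorem firstValue_mono {ψ : List Bool → ℕ → Option Bool} {u v : List Bool} {j : ℕ} {b : Bool}
    (huv : u <+: v) (h : firstValue ψ u j = some b) : firstValue ψ v j = some b := by
  obtain ⟨t, rfl⟩ := huv
  unfold firstValue at *
  rw [List.length_append, show u.length + t.length + 1 = (u.length + 1) + t.length by omega,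
    List.range_add, List.filterMap_append, List.head?_append]
  have : (List.range (u.length + 1)).filterMap (fun m => ψ ((u ++ t).take m) j) =
      (List.range (u.length + 1)).filterMap (fun m => ψ (u.take m) j) := by
    refine List.filterMap_congr fun m hm => ?_
    rw [List.take_append_of_le_length (by have := List.mem_range.1 hm; omega)]
  rw [this, h]
  rfl

/-- `q` is the sequence that is described by `ψ` on the initial segments of `p`. -/
def Describes (ψ : List Bool → ℕ → Option Bool) (p q : Cantor) : Prop :=
  ∀ j, (∃ m, ψ (initialWord p m) j = some (q j)) ∧
    ∀ m b, ψ (initialWord p m) j = some b → b = q j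

theorem Describes.unique {ψ : List Bool → ℕ → Option Bool} {p q q' : Cantor}
    (h : Describes ψ p q) (h' : Describes ψ p q') : q = q' := by
  funext j
  obtain ⟨m, hm⟩ := (h j).1
  exact (h' j).2 m _ hm

theorem Describes.firstValue_eq {ψ : List Bool → ℕ → Option Bool} {p q : Cantor}
    (h : Describes ψ p q) {m j : ℕ} {b : Bool} (hb : firstValue ψ (initialWord p m) j = some b) :
    b = q j := by
  have := List.mem_of_mem_head? hb
  rw [List.mem_filterMap] at this
  obtain ⟨l, hl, hlb⟩ := this
  rw [length_initialWord, List.mem_range] at hl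
  rw [take_initialWord p (by omega)] at hlb
  exact (h j).2 _ _ hlb

theorem isSome_firstValue {ψ : List Bool → ℕ → Option Bool} {p : Cantor} {m l j : ℕ} {b : Bool}
    (hl : l ≤ m) (hb : ψ (initialWord p l) j = some b) :
    (firstValue ψ (initialWord p m) j).isSome := by
  rw [firstValue, List.isSome_head?]
  refine List.ne_nil_of_mem (a := b) (List.mem_filterMap.2 ⟨l, ?_, ?_⟩)
  · rw [length_initialWord, List.mem_range]
    omega
  · rwa [take_initialWord p hl]

/-- The partial function that is described by `ψ`. -/
noncomputable def describedFun (ψ : List Bool → ℕ → Option Bool) : Cantor →. Cantor :=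
  fun p => ⟨∃ q, Describes ψ p q, fun h => h.choose⟩

theorem mem_describedFun {ψ : List Bool → ℕ → Option Bool} {p q : Cantor} :
    q ∈ describedFun ψ p ↔ Describes ψ p q := by
  constructor
  · rintro ⟨h, rfl⟩
    exact h.choose_spec
  · intro h
    have hex : ∃ q, Describes ψ p q := ⟨q, h⟩
    exact ⟨hex, hex.choose_spec.unique h⟩

theorem primrec_firstValue {ψ : List Bool → ℕ → Option Bool} (hψ : Primrec₂ ψ) :
    Primrec₂ (firstValue ψ) := by
  refine Primrec.list_head?.comp (Primrec.listFilterMap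
    (f := fun a : List Bool × ℕ => List.range (a.1.length + 1)) ?_ ?_)
  · exact Primrec.list_range.comp (Primrec.succ.comp (Primrec.list_length.comp Primrec.fst))
  · exact hψ.comp (Primrec.list_take.comp Primrec.snd (Primrec.fst.comp Primrec.fst))
      (Primrec.snd.comp Primrec.fst)

/-- The machine writes the longest beginning all of whose letters have already been found. Capping
its length by that of the input keeps the search primitive recursive and does not prevent the output
from growing without bound. -/
theorem type2Computable_describedFun {ψ : List Bool → ℕ → Option Bool} (hψ : Primrec₂ ψ) :
    Type2Computable (describedFun ψ) := by
  let len : List Bool → ℕ := fun w =>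
    Nat.findGreatest (fun l => ∀ i < l, (firstValue ψ w i).isSome) w.length
  have hlen : ∀ w, ∀ i < len w, (firstValue ψ w i).isSome := fun w =>
    Nat.findGreatest_spec (P := fun l => ∀ i < l, (firstValue ψ w i).isSome) (Nat.zero_le _)
      (by simp)
  have hmono : ∀ u v, u <+: v → len u ≤ len v := fun u v huv =>
    Nat.le_findGreatest ((Nat.findGreatest_le _).trans huv.length_le) fun i hi => by
      obtain ⟨b, hb⟩ := Option.isSome_iff_exists.1 (hlen u i hi)
      rw [firstValue_mono huv hb]
      rfl
  refine ⟨fun w => (List.range (len w)).map fun j => (firstValue ψ w j).getD false, ?_, ?_, ?_⟩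
  · have hR : PrimrecRel fun (i : ℕ) (w : List Bool) => (firstValue ψ w i).isSome = true :=
      PrimrecRel.comp Primrec.eq (Primrec.option_isSome.comp
        ((primrec_firstValue hψ).comp Primrec.snd Primrec.fst)) (Primrec.const true)
    have h1 : Primrec len := Primrec.nat_findGreatest Primrec.list_length
      ((hR.forall_mem_list.comp (Primrec.list_range.comp Primrec.snd) Primrec.fst).of_eq
        (by simp))
    refine (Primrec.list_map (Primrec.list_range.comp h1) ?_).to_comp
    exact Primrec.option_getD.comp ((primrec_firstValue hψ).comp Primrec.fst Primrec.snd)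
      (Primrec.const false)
  · intro u v huv
    rw [List.prefix_iff_eq_take]
    simp only [List.length_map, List.length_range, ← List.map_take, List.take_range]
    rw [Nat.min_eq_left (hmono u v huv)]
    refine List.map_congr_left fun j hj => ?_
    obtain ⟨b, hb⟩ := Option.isSome_iff_exists.1 (hlen u j (List.mem_range.1 hj))
    rw [hb, firstValue_mono huv hb]
  · intro p q hq
    rw [mem_describedFun] at hq
    refine ⟨fun m => ?_, fun n => ?_⟩
    · simp only [List.length_map, List.length_range]
      refine List.map_congr_left fun j hj => ?_
      obtain ⟨b, hb⟩ := Option.isSome_iff_exists.1 (hlen _ j (List.mem_range.1 hj))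
      rw [hb, Option.getD_some, hq.firstValue_eq hb]
    · choose m hm using fun j => (hq j).1
      refine ⟨n + (Finset.range n).sup m, ?_⟩
      simp only [List.length_map, List.length_range]
      refine Nat.le_findGreatest (by simp) fun i hi => ?_
      exact isSome_firstValue (l := m i)
        ((Finset.le_sup (f := m) (Finset.mem_range.2 hi)).trans (by omega)) (hm i)

end Type2

/-! ### Applying a causal function to all entries of a tuple. -/

section Componentwise

theorem idxOf_initialWord_tagged (n : ℕ) (p : Cantor) (m : ℕ) :
    (initialWord (tagged n p) m).idxOf true = min n m := by
  induction m with
  | zero => simp [initialWord]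
  | succ m ih =>
    rw [initialWord_succ, List.idxOf_append, ih, length_initialWord]
    have hmem : true ∈ initialWord (tagged n p) m ↔ n < m := by
      rw [← List.idxOf_lt_length_iff, ih, length_initialWord]
      omega
    by_cases h : n < m
    · rw [if_pos (hmem.2 h)]
      omega
    · rw [if_neg (mt hmem.1 h)]
      rcases (not_lt.1 h).eq_or_lt with rfl | h'
      · simp [tagged_apply_self]
      · rw [tagged_apply_of_lt _ h']
        simp
        omega

/-- The letter at position `j = w.length - 1` when `h` is applied to the components of a name
of a tuple. -/
def componentwise (h : List Bool → Bool) (w : List Bool) : Bool :=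
  let n := w.idxOf true
  let j := w.length - 1
  if j < n then false else if j = n then true else
    h ((List.range ((j - n - 1).unpair.2 + 1)).map fun l =>
      w.getD (n + 1 + Nat.pair (j - n - 1).unpair.1 l) false)

theorem primrec_componentwise {h : List Bool → Bool} (hh : Primrec h) :
    Primrec (componentwise h) := by
  have hn : Primrec fun w : List Bool => w.idxOf true :=
    Primrec.list_idxOf.comp (Primrec.const true) Primrec.id
  have hj : Primrec fun w : List Bool => w.length - 1 := Primrec.pred.comp Primrec.list_length
  have hd : Primrec fun w : List Bool => (w.length - 1 - w.idxOf true - 1).unpair :=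
    Primrec.unpair.comp (Primrec.pred.comp ((Primrec.nat_sub.comp hj hn :
      Primrec fun w : List Bool => w.length - 1 - w.idxOf true)))
  refine Primrec.ite (Primrec.nat_lt.comp hj hn) (Primrec.const false)
    (Primrec.ite (Primrec.eq.comp hj hn) (Primrec.const true) (hh.comp (Primrec.list_map
      (Primrec.list_range.comp (Primrec.succ.comp (Primrec.snd.comp hd))) ?_)))
  exact (Primrec.list_getD false).comp Primrec.fst (Primrec.nat_add.comp
    (Primrec.succ.comp (hn.comp Primrec.fst)) (Primrec₂.natPair.comp
      (Primrec.fst.comp (hd.comp Primrec.fst)) Primrec.snd))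

/-- Letter `l` of component `i` stands behind the tag at `Nat.pair i l`, which increases with `l`.
So the letters needed for an output letter stand no later than that letter itself. -/
theorem causal_componentwise_tagged (h : List Bool → Bool) (n : ℕ) (p : Cantor) :
    causal (componentwise h) (tagged n p) =
      tagged n fun m => causal h (fun l => p (Nat.pair m.unpair.1 l)) m.unpair.2 := by
  funext j
  rw [causal, componentwise, idxOf_initialWord_tagged, length_initialWord]
  simp only [Nat.add_sub_cancel]
  rcases lt_trichotomy j n with hlt | rfl | hgt
  · rw [if_pos (by omega), tagged_apply_of_lt _ hlt]
  · rw [if_neg (by omega), if_pos (by omega), tagged_apply_self]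
  · obtain ⟨m, rfl⟩ : ∃ m, j = n + 1 + m := ⟨j - n - 1, by omega⟩
    rw [if_neg (by omega), if_neg (by omega), tagged_apply_add,
      show min n (n + 1 + m + 1) = n by omega, show n + 1 + m - n - 1 = m by omega, causal]
    congr 1
    refine List.map_congr_left fun l hl => ?_
    have hl : l ≤ m.unpair.2 := by
      have := List.mem_range.1 hl
      omega
    have h1 : Nat.pair m.unpair.1 l ≤ m := by
      conv_rhs => rw [← Nat.pair_unpair m]
      exact hl.lt_or_eq.elim (fun h => (Nat.pair_lt_pair_right _ h).le) fun h => by rw [h]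
    rw [getD_initialWord _ (by omega), tagged_apply_add]

theorem names_causal_componentwise {X Y : Type*} [Represented X] [Represented Y]
    {h : List Bool → Bool} {p : Cantor} {n : ℕ} {x : Fin n → X} {y : Fin n → Y}
    (hp : names p (⟨n, x⟩ : Tuples X)) (hh : ∀ i q, names q (x i) → names (causal h q) (y i)) :
    names (causal (componentwise h) p) (⟨n, y⟩ : Tuples Y) := by
  obtain ⟨r, rfl, hr⟩ := hp
  dsimp only at hr
  rw [causal_componentwise_tagged]
  refine ⟨_, rfl, fun i => ?_⟩
  simp only [Nat.unpair_pair]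
  exact hh i _ (hr i)

end Componentwise

/-! ### Zero tests on names of reals, and reals made from bit sequences. -/

section Codes

theorem primrec_two_pow : Primrec fun n : ℕ => 2 ^ n :=
  (Primrec₂.unpaired'.1 Nat.Primrec.pow).comp (Primrec.const 2) Primrec.id

theorem primrec_scan : Primrec scan := by
  refine Primrec.list_foldl (α := List Bool) (β := Bool) (σ := ℕ × ℕ)
    (h := fun _ x => if x.2 then (x.1.1 + 1, 0) else (x.1.1, x.1.2 + 1))
    Primrec.id (Primrec.const (0, 0)) ?_
  have ha : Primrec fun a : List Bool × (ℕ × ℕ) × Bool => a.2.1 := Primrec.fst.comp Primrec.snd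
  have hb : Primrec fun a : List Bool × (ℕ × ℕ) × Bool => a.2.2 := Primrec.snd.comp Primrec.snd
  exact Primrec.ite (Primrec.eq.comp hb (Primrec.const true))
    (Primrec.pair (Primrec.succ.comp (Primrec.fst.comp ha)) (Primrec.const 0))
    (Primrec.pair (Primrec.fst.comp ha) (Primrec.succ.comp (Primrec.snd.comp ha)))

/-- Decides whether the absolute value of the rational with code `t` is less than `2^{-a}`. -/
def smallCode (a t : ℕ) : Bool :=
  decide (((t.unpair.1.unpair.1 - t.unpair.1.unpair.2) +
    (t.unpair.1.unpair.2 - t.unpair.1.unpair.1)) * 2 ^ a < t.unpair.2 + 1)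

theorem smallCode_iff (a t : ℕ) : smallCode a t = true ↔ |ratEnum t| < (1 / 2 : ℚ) ^ a := by
  rw [smallCode, decide_eq_true_iff, ratEnum, abs_div,
    abs_of_pos (show (0 : ℚ) < (t.unpair.2 : ℚ) + 1 by positivity), div_lt_iff₀ (by positivity),
    one_div, inv_pow, ← div_eq_inv_mul, lt_div_iff₀ (by positivity)]
  have : |(t.unpair.1.unpair.1 : ℚ) - (t.unpair.1.unpair.2 : ℚ)| =
      (((t.unpair.1.unpair.1 - t.unpair.1.unpair.2) +
        (t.unpair.1.unpair.2 - t.unpair.1.unpair.1) : ℕ) : ℚ) := by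
    rcases le_total t.unpair.1.unpair.1 t.unpair.1.unpair.2 with h | h
    · rw [abs_of_nonpos (by rw [sub_nonpos]; exact_mod_cast h), Nat.sub_eq_zero_of_le h]
      push_cast [h]
      ring
    · rw [abs_of_nonneg (by rw [sub_nonneg]; exact_mod_cast h), Nat.sub_eq_zero_of_le h]
      push_cast [h]
      ring
  rw [this]
  exact_mod_cast Iff.rfl

theorem primrec_smallCode : Primrec₂ smallCode := by
  have ht : Primrec fun x : ℕ × ℕ => x.2.unpair := Primrec.unpair.comp Primrec.snd
  have ht1 : Primrec fun x : ℕ × ℕ => x.2.unpair.1.unpair :=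
    Primrec.unpair.comp (Primrec.fst.comp ht)
  have h1 := Primrec.fst.comp ht1
  have h2 := Primrec.snd.comp ht1
  exact (Primrec.nat_lt.comp (Primrec.nat_mul.comp (Primrec.nat_add.comp
    (Primrec.nat_sub.comp h1 h2) (Primrec.nat_sub.comp h2 h1))
    (primrec_two_pow.comp Primrec.fst)) (Primrec.succ.comp (Primrec.snd.comp ht))).decide

/-- On a name of a real `x` this produces the zero sequence if and only if `x = 0`. -/
def zeroTestWord (w : List Bool) : Bool :=
  w.getD (w.length - 1) false &&
    !smallCode (scan (w.take (w.length - 1))).1 (scan (w.take (w.length - 1))).2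

theorem primrec_zeroTestWord : Primrec zeroTestWord := by
  have hl : Primrec fun w : List Bool => w.length - 1 := Primrec.pred.comp Primrec.list_length
  have hs : Primrec fun w : List Bool => scan (w.take (w.length - 1)) :=
    primrec_scan.comp (Primrec.list_take.comp hl Primrec.id)
  exact Primrec.and.comp ((Primrec.list_getD false).comp Primrec.id hl)
    (Primrec.not.comp (primrec_smallCode.comp (Primrec.fst.comp hs) (Primrec.snd.comp hs)))

theorem causal_zeroTestWord {p : Cantor} {x : ℝ} (hp : names p x) :
    (∀ k, causal zeroTestWord p k = false) ↔ x = 0 := by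
  -- A letter `1` can be written only where a block ends, since its length, the code of the
  -- rational, is known only there.
  obtain ⟨s, rfl, hs⟩ := hp
  have key : ∀ j t, t ≤ s j → causal zeroTestWord (blocks s) (blockStart s j + t) =
      (decide (t = s j) && !smallCode j t) := by
    intro j t ht
    rw [causal, zeroTestWord, length_initialWord, Nat.add_sub_cancel,
      take_initialWord _ (Nat.le_succ _), getD_initialWord _ (Nat.lt_succ_self _),
      scan_initialWord_blocks ht, blocks_apply ht]
  rw [eq_zero_iff_forall_abs_lt hs]
  constructor
  · intro h j
    have := h (blockStart s j + s j)
    rw [key j _ le_rfl] at this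
    rw [← smallCode_iff]
    simpa using this
  · intro h k
    obtain ⟨j, t, ht, rfl⟩ := exists_block s k
    rw [key j t ht]
    by_cases hts : t = s j
    · have := (smallCode_iff j t).2 (by rw [hts]; exact h j)
      simp [this]
    · simp [hts]

/-- A closed form of the code of a sequence that is `0` up to `f` and constant from then on: `f`
letters `1`, then a periodic pattern. It makes the names written below computable letter by letter.
-/
theorem blocks_eventually_const (f C k : ℕ) :
    blocks (fun l => if l < f then 0 else C) k =
      if k < f then true else decide ((k - f + 1) % (C + 1) = 0) := by
  set s : ℕ → ℕ := fun l => if l < f then 0 else C with hs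
  have h1 : ∀ l ≤ f, blockStart s l = l := by
    intro l
    induction l with
    | zero => simp [blockStart]
    | succ l ih =>
      intro hl
      rw [blockStart_succ, ih (by omega)]
      simp [hs, show l < f by omega]
  have h2 : ∀ m, blockStart s (f + m) = f + m * (C + 1) := by
    intro m
    induction m with
    | zero => simpa using h1 f le_rfl
    | succ m ih =>
      rw [← add_assoc, blockStart_succ, ih]
      simp only [hs, show ¬ f + m < f by omega, if_false]
      ring
  obtain ⟨j, t, ht, rfl⟩ := exists_block s k
  rw [blocks_apply ht]
  by_cases hj : j < f
  · have : s j = 0 := by simp [hs, hj]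
    rw [this] at ht ⊢
    rw [h1 j hj.le]
    obtain rfl : t = 0 := by omega
    simp [hj]
  · obtain ⟨m, rfl⟩ : ∃ m, j = f + m := ⟨j - f, by omega⟩
    have hC : s (f + m) = C := by simp [hs]
    rw [hC] at ht ⊢
    rw [h2, if_neg (by omega), decide_eq_decide,
      show f + m * (C + 1) + t - f + 1 = t + 1 + m * (C + 1) by omega, Nat.add_mul_mod_self_right]
    rcases ht.lt_or_eq with h | rfl
    · rw [Nat.mod_eq_of_lt (by omega)]
      omega
    · simp

/-- A code of the rational `2^{-f}`. -/
def powCode (f : ℕ) : ℕ := Nat.pair (Nat.pair 1 0) (2 ^ f - 1)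

theorem ratEnum_powCode (f : ℕ) : ratEnum (powCode f) = (1 / 2 : ℚ) ^ f := by
  have : ((2 ^ f - 1 : ℕ) : ℚ) + 1 = 2 ^ f := by
    have := Nat.sub_add_cancel (Nat.one_le_two_pow (n := f))
    exact_mod_cast this
  simp [ratEnum, powCode]

/-- On a sequence `p` this produces a name of `2^{-f}`, where `f` is the position of the first
letter `1` in `p`, or a name of `0` if there is none. -/
def powWord (w : List Bool) : Bool :=
  if w.length - 1 < w.idxOf true then true
  else decide ((w.length - 1 - w.idxOf true + 1) % (powCode (w.idxOf true) + 1) = 0)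

theorem primrec_powWord : Primrec powWord := by
  have hl : Primrec fun w : List Bool => w.length - 1 := Primrec.pred.comp Primrec.list_length
  have hf : Primrec fun w : List Bool => w.idxOf true :=
    Primrec.list_idxOf.comp (Primrec.const true) Primrec.id
  have hc : Primrec powCode := Primrec₂.natPair.comp (Primrec.const _)
    (Primrec.pred.comp primrec_two_pow)
  exact Primrec.ite (Primrec.nat_lt.comp hl hf) (Primrec.const true)
    (Primrec.eq.comp (Primrec.nat_mod.comp (Primrec.succ.comp (Primrec.nat_sub.comp hl hf))
      (Primrec.succ.comp (hc.comp hf))) (Primrec.const 0)).decide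

open Classical in
/-- The real `2^{-f}`, where `f` is the position of the first letter `1` in `p`, or `0`. -/
noncomputable def powReal (p : Cantor) : ℝ :=
  if h : ∃ f, p f = true then (1 / 2 : ℝ) ^ Nat.find h else 0

theorem powReal_eq_zero_iff (p : Cantor) : powReal p = 0 ↔ ∀ n, p n = false := by
  unfold powReal
  split_ifs with h
  · obtain ⟨f, hf⟩ := h
    refine iff_of_false (by positivity) fun h' => ?_
    rw [h' f] at hf
    simp at hf
  · simpa using h

theorem names_causal_powWord (p : Cantor) : names (causal powWord p) (powReal p) := by
  by_cases h : ∃ f, p f = true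
  · set f := Nat.find h with hf
    have hp : p = tagged f fun k => p (f + 1 + k) := by
      funext k
      rcases lt_trichotomy k f with hlt | heq | hgt
      · rw [tagged_apply_of_lt _ hlt]
        simpa using Nat.find_min h hlt
      · rw [heq, tagged_apply_self]
        exact Nat.find_spec h
      · obtain ⟨m, rfl⟩ : ∃ m, k = f + 1 + m := ⟨k - f - 1, by omega⟩
        rw [tagged_apply_add]
    refine ⟨fun l => if l < f then 0 else powCode f, ?_, fun l => ?_⟩
    · funext k
      rw [blocks_eventually_const, causal, powWord]
      have : (initialWord p (k + 1)).idxOf true = min f (k + 1) := by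
        rw [hp]
        exact idxOf_initialWord_tagged _ _ _
      rw [this, length_initialWord, Nat.add_sub_cancel]
      by_cases hk : k < f
      · rw [if_pos (by omega), if_pos hk]
      · rw [if_neg (by omega), if_neg hk, Nat.min_eq_left (by omega)]
    · have hval : powReal p = (1 / 2 : ℝ) ^ f := by
        rw [powReal, dif_pos h]
      rw [hval]
      -- Before the first letter `1` of `p` is seen, the rational `0`, whose code is `0`, is a safe
      -- approximation: `2^{-f} < 2^{-l}` for `l < f`.
      by_cases hl : l < f
      · have h0 : ratEnum 0 = 0 := by simp [ratEnum]
        simp only [if_pos hl]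
        rw [h0, Rat.cast_zero, sub_zero, abs_of_pos (by positivity)]
        exact pow_lt_pow_right_of_lt_one₀ (by norm_num) (by norm_num) hl
      · simp only [if_neg hl]
        rw [ratEnum_powCode]
        push_cast
        rw [sub_self, abs_zero]
        positivity
  · have hp : ∀ k, p k = false := by simpa using h
    refine ⟨fun l => if l < 0 then 0 else 0, ?_, fun l => ?_⟩
    · funext k
      rw [blocks_eventually_const, causal, powWord]
      have : (initialWord p (k + 1)).idxOf true = k + 1 := by
        rw [List.idxOf_eq_length, length_initialWord]
        simp [initialWord, hp]
      rw [this, length_initialWord, Nat.add_sub_cancel, if_pos (by omega)]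
      simp [Nat.mod_one]
    · rw [powReal, dif_neg h]
      simp [ratEnum]

end Codes

theorem length_filter_range (n : ℕ) (p : ℕ → Bool) :
    ((List.range n).filter p).length = (Finset.univ.filter fun i : Fin n => p i = true).card := by
  have h1 : ((List.range n).filter p).length = ((Finset.range n).filter fun i => p i = true).card := by
    simp [Finset.card, Finset.filter, Finset.range, Multiset.range]
  rw [h1, ← Nat.Iio_eq_range, ← Fin.map_valEmbedding_univ, Finset.filter_map, Finset.card_map]
  rfl

/-- The word at the even positions. -/
def evensWord (w : List Bool) : List Bool :=
  (List.range (w.length / 2)).map fun k => w.getD (2 * k) false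

/-- The word at the odd positions. -/
def oddsWord (w : List Bool) : List Bool :=
  (List.range (w.length / 2)).map fun k => w.getD (2 * k + 1) false

theorem evensWord_pairing (p r : Cantor) (m : ℕ) :
    evensWord (initialWord (pairing p r) m) = initialWord p (m / 2) := by
  rw [evensWord, length_initialWord]
  refine List.map_congr_left fun k hk => ?_
  have := List.mem_range.1 hk
  rw [getD_initialWord _ (by omega), congrFun (evens_pairing p r) k]

theorem oddsWord_pairing (p r : Cantor) (m : ℕ) :
    oddsWord (initialWord (pairing p r) m) = initialWord r (m / 2) := by
  rw [oddsWord, length_initialWord]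
  refine List.map_congr_left fun k hk => ?_
  have := List.mem_range.1 hk
  rw [getD_initialWord _ (by omega), congrFun (odds_pairing p r) k]

theorem primrec_evensWord : Primrec evensWord :=
  Primrec.list_map (Primrec.list_range.comp (Primrec.nat_div.comp Primrec.list_length
    (Primrec.const 2))) ((Primrec.list_getD false).comp Primrec.fst
      (Primrec.nat_double.comp Primrec.snd))

theorem primrec_oddsWord : Primrec oddsWord :=
  Primrec.list_map (Primrec.list_range.comp (Primrec.nat_div.comp Primrec.list_length
    (Primrec.const 2))) ((Primrec.list_getD false).comp Primrec.fst
      (Primrec.nat_double_succ.comp Primrec.snd))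

/-- The constant tuple whose length and whose value are given by the number of zeros of `x`. -/
noncomputable def constTuple (ℓ v : ℕ → ℕ) (x : Tuples ℝ) : Tuples ℝ :=
  ⟨ℓ (zeroCount x), fun _ => (v (zeroCount x) : ℝ)⟩

theorem lpoStar_apply_eq_true (z : Tuples Cantor) (i : Fin z.1) :
    (lpoStar z).2 i = true ↔ ∀ n, z.2 i n = false := by
  simp [lpoStar]

/-! ### Counting zeros with `LPO.star`. -/

section Forward

/-- The number of entries `1` of a tuple of bits, read off from a beginning of a name. -/
def countBits (o : List Bool) : Option ℕ :=
  -- This length makes the first letter of every component visible, because pairing increases in its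
  -- first argument. If the tag is incomplete, `idxOf` is the length of the word and the test fails.
  if o.idxOf true + 1 + Nat.pair (o.idxOf true) 0 < o.length then
    some ((List.range (o.idxOf true)).filter fun i =>
      o.getD (o.idxOf true + 1 + Nat.pair i 0) false = true).length
  else none

theorem primrec_countBits : Primrec countBits := by
  have hn : Primrec fun o : List Bool => o.idxOf true :=
    Primrec.list_idxOf.comp (Primrec.const true) Primrec.id
  have hR : PrimrecRel fun (i : ℕ) (o : List Bool) =>
      o.getD (o.idxOf true + 1 + Nat.pair i 0) false = true :=
    Primrec.eq.comp ((Primrec.list_getD false).comp Primrec.snd (Primrec.nat_add.comp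
      (Primrec.succ.comp (hn.comp Primrec.snd)) (Primrec₂.natPair.comp Primrec.fst
        (Primrec.const 0)))) (Primrec.const true)
  refine Primrec.ite (Primrec.nat_lt.comp (Primrec.nat_add.comp (Primrec.succ.comp hn)
    (Primrec₂.natPair.comp hn (Primrec.const 0))) Primrec.list_length)
    (Primrec.option_some.comp (Primrec.list_length.comp ?_)) (Primrec.const none)
  exact hR.listFilter.comp (Primrec.list_range.comp hn) Primrec.id

theorem countBits_initialWord (n : ℕ) (r : Cantor) (m : ℕ) :
    countBits (initialWord (tagged n r) m) =
      if n + 1 + Nat.pair n 0 < m then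
        some (Finset.univ.filter fun i : Fin n => r (Nat.pair i 0) = true).card
      else none := by
  rw [countBits, idxOf_initialWord_tagged, length_initialWord]
  by_cases h : n < m
  · rw [Nat.min_eq_left h.le]
    by_cases h2 : n + 1 + Nat.pair n 0 < m
    · rw [if_pos h2, if_pos h2, length_filter_range]
      congr 2
      ext i
      have := Nat.pair_lt_pair_left 0 i.2
      rw [Finset.mem_filter, Finset.mem_filter, getD_initialWord _ (by omega), tagged_apply_add]
      simp
    · rw [if_neg h2, if_neg h2]
  · rw [if_neg (by omega), if_neg (by omega)]

/-- A name of the tuple of length `ℓ c` with all entries `v c`. -/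
def constBit (ℓ v : ℕ → ℕ) (c j : ℕ) : Bool :=
  if j < ℓ c then false else if j = ℓ c then true else
    decide (((j - ℓ c - 1).unpair.2 + 1) % (Nat.pair (Nat.pair (v c) 0) 0 + 1) = 0)

theorem primrec_constBit {ℓ v : ℕ → ℕ} (hℓ : Primrec ℓ) (hv : Primrec v) :
    Primrec₂ (constBit ℓ v) := by
  have h1 : Primrec fun x : ℕ × ℕ => ℓ x.1 := hℓ.comp Primrec.fst
  have h2 : Primrec fun x : ℕ × ℕ => v x.1 := hv.comp Primrec.fst
  have h3 : Primrec fun x : ℕ × ℕ => x.2 - ℓ x.1 := Primrec.nat_sub.comp Primrec.snd h1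
  exact Primrec.ite (Primrec.nat_lt.comp Primrec.snd h1) (Primrec.const false)
    (Primrec.ite (Primrec.eq.comp Primrec.snd h1) (Primrec.const true)
      (Primrec.eq.comp (Primrec.nat_mod.comp
        (Primrec.succ.comp (Primrec.snd.comp (Primrec.unpair.comp (Primrec.pred.comp h3))))
        (Primrec.succ.comp (Primrec₂.natPair.comp (Primrec₂.natPair.comp h2 (Primrec.const 0))
          (Primrec.const 0)))) (Primrec.const 0)).decide)

theorem names_constBit (ℓ v : ℕ → ℕ) (c : ℕ) :
    names (constBit ℓ v c) (⟨ℓ c, fun _ => (v c : ℝ)⟩ : Tuples ℝ) := by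
  -- The code of the integer `v c` as a rational; repeating it is an exact name.
  set C := Nat.pair (Nat.pair (v c) 0) 0 with hC
  refine ⟨fun m => decide ((m.unpair.2 + 1) % (C + 1) = 0), rfl, fun i =>
    ⟨fun l => if l < 0 then 0 else C, ?_, fun l => ?_⟩⟩
  · funext k
    rw [blocks_eventually_const]
    simp
  · simp [hC, ratEnum]

theorem constTuple_le_lpoStar {ℓ v : ℕ → ℕ} (hℓ : Primrec ℓ) (hv : Primrec v) :
    WeihrauchLE (MultiFun.ofFun (constTuple ℓ v)) LPO.star := by
  let ψ : List Bool → ℕ → Option Bool := fun w j =>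
    (countBits (oddsWord w)).map fun c => constBit ℓ v c j
  have hψ : Primrec₂ ψ := by
    refine Primrec.option_map (primrec_countBits.comp (primrec_oddsWord.comp Primrec.fst)) ?_
    exact (primrec_constBit hℓ hv).comp Primrec.snd (Primrec.snd.comp Primrec.fst)
  rw [LPO_star_eq]
  refine ⟨describedFun ψ, fun p => Part.some (causal (componentwise zeroTestWord) p),
    type2Computable_describedFun hψ,
    type2Computable_causal (primrec_componentwise primrec_zeroTestWord),
    fun G hG => realizes_sandwich ?_ G hG⟩
  rintro p ⟨n, x⟩ hp
  obtain ⟨p', rfl, hp'⟩ := hp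
  dsimp only at hp'
  refine ⟨_, Part.mem_some _, ⟨n, fun i => causal zeroTestWord fun l => p' (Nat.pair i l)⟩, ?_, ?_⟩
  · rw [causal_componentwise_tagged]
    refine ⟨_, rfl, fun i => ?_⟩
    simp only [Nat.unpair_pair]
    rfl
  · rintro r ⟨r', rfl, hr⟩
    have hcard : (Finset.univ.filter fun i : Fin n => r' (Nat.pair i 0) = true).card =
        zeroCount ⟨n, x⟩ := by
      unfold zeroCount
      congr 1
      ext i
      have h1 : r' (Nat.pair i 0) = _ := hr i
      rw [Finset.mem_filter, Finset.mem_filter, h1]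
      exact and_congr_right fun _ =>
        (lpoStar_apply_eq_true _ _).trans (causal_zeroTestWord (hp' i))
    refine ⟨constBit ℓ v (zeroCount ⟨n, x⟩), ?_, names_constBit ℓ v _⟩
    rw [mem_describedFun]
    intro j
    simp only [ψ, oddsWord_pairing]
    dsimp only [lpoStar]
    simp only [countBits_initialWord, hcard]
    refine ⟨⟨2 * (n + 1 + Nat.pair n 0 + 1), ?_⟩, fun m b hb => ?_⟩
    · rw [if_pos (by omega)]
      rfl
    · split_ifs at hb with h
      · simpa using hb.symm
      · simp at hb

end Forward

/-! ### Recovering `LPO.star` from the number of zeros. -/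

section Backward

/-- Whether a letter `1` is seen in the `i`-th component of a beginning of a name. -/
def Seen (e : List Bool) (i : ℕ) : Prop :=
  ∃ l ∈ List.range e.length, (e.idxOf true < l ∧ (l - e.idxOf true - 1).unpair.1 = i) ∧
    e.getD l false = true

instance (e : List Bool) (i : ℕ) : Decidable (Seen e i) := by
  unfold Seen
  infer_instance

theorem primrecRel_seen : PrimrecRel fun (i : ℕ) (e : List Bool) => Seen e i := by
  have hn : Primrec fun x : ℕ × (ℕ × List Bool) => x.2.2.idxOf true :=
    Primrec.list_idxOf.comp (Primrec.const true) (Primrec.snd.comp Primrec.snd)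
  have hd : Primrec fun x : ℕ × (ℕ × List Bool) => x.1 - x.2.2.idxOf true :=
    Primrec.nat_sub.comp Primrec.fst hn
  have hR : PrimrecRel fun (l : ℕ) (x : ℕ × List Bool) =>
      (x.2.idxOf true < l ∧ (l - x.2.idxOf true - 1).unpair.1 = x.1) ∧ x.2.getD l false = true :=
    ((Primrec.nat_lt.comp hn Primrec.fst).and (Primrec.eq.comp (Primrec.fst.comp
      (Primrec.unpair.comp (Primrec.pred.comp hd))) (Primrec.fst.comp Primrec.snd))).and
      (Primrec.eq.comp ((Primrec.list_getD false).comp (Primrec.snd.comp Primrec.snd) Primrec.fst)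
        (Primrec.const true))
  exact hR.exists_mem_list.comp (Primrec.list_range.comp (Primrec.list_length.comp Primrec.snd))
    Primrec.id

theorem seen_initialWord {n : ℕ} {p : Cantor} {m i : ℕ} (hm : n < m) :
    Seen (initialWord (tagged n p) m) i ↔ ∃ k, n + 1 + Nat.pair i k < m ∧ p (Nat.pair i k) = true := by
  rw [Seen, idxOf_initialWord_tagged, length_initialWord, Nat.min_eq_left hm.le]
  constructor
  · rintro ⟨l, hl, ⟨h1, h2⟩, h3⟩
    have hl := List.mem_range.1 hl
    obtain ⟨a, rfl⟩ : ∃ a, l = n + 1 + a := ⟨l - n - 1, by omega⟩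
    rw [getD_initialWord _ hl, tagged_apply_add] at h3
    rw [show n + 1 + a - n - 1 = a by omega] at h2
    have ha : Nat.pair i a.unpair.2 = a := by rw [← h2, Nat.pair_unpair]
    exact ⟨a.unpair.2, by rw [ha]; exact hl, by rw [ha]; exact h3⟩
  · rintro ⟨k, hk, hpk⟩
    refine ⟨_, List.mem_range.2 hk, ⟨by omega, ?_⟩, ?_⟩
    · rw [show n + 1 + Nat.pair i k - n - 1 = Nat.pair i k by omega, Nat.unpair_pair]
    · rw [getD_initialWord _ hk, tagged_apply_add, hpk]

/-- The number of components in which no letter `1` is seen. -/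
def unseenCount (e : List Bool) : ℕ :=
  ((List.range (e.idxOf true)).filter fun i => ¬ Seen e i).length

theorem primrec_unseenCount : Primrec unseenCount :=
  Primrec.list_length.comp (primrecRel_seen.not.listFilter.comp (Primrec.list_range.comp
    (Primrec.list_idxOf.comp (Primrec.const true) Primrec.id)) Primrec.id)

/-- The name of a tuple of bits whose entry `i` is `1` if `i` is not seen. -/
def unseenBit (e : List Bool) (j : ℕ) : Bool :=
  if j < e.idxOf true then false else if j = e.idxOf true then true else
    decide ((j - e.idxOf true - 1).unpair.1 < e.idxOf true ∧
      ¬ Seen e (j - e.idxOf true - 1).unpair.1)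

theorem primrec_unseenBit : Primrec₂ unseenBit := by
  have hn : Primrec fun x : List Bool × ℕ => x.1.idxOf true :=
    Primrec.list_idxOf.comp (Primrec.const true) Primrec.fst
  have hd : Primrec fun x : List Bool × ℕ => x.2 - x.1.idxOf true :=
    Primrec.nat_sub.comp Primrec.snd hn
  have hi : Primrec fun x : List Bool × ℕ => (x.2 - x.1.idxOf true - 1).unpair.1 :=
    Primrec.fst.comp (Primrec.unpair.comp (Primrec.pred.comp hd))
  exact Primrec.ite (Primrec.nat_lt.comp Primrec.snd hn) (Primrec.const false)
    (Primrec.ite (Primrec.eq.comp Primrec.snd hn) (Primrec.const true)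
      ((Primrec.nat_lt.comp hi hn).and (primrecRel_seen.not.comp hi Primrec.fst)).decide)

/-- `dec` finds the number `c` from all sufficiently long beginnings of `r`, and never finds
another number. -/
def Finds (dec : List Bool → Option ℕ) (r : Cantor) (c : ℕ) : Prop :=
  (∀ m a, dec (initialWord r m) = some a → a = c) ∧ ∃ M, ∀ m ≥ M, dec (initialWord r m) = some c

/-- The components without a visible `1` always include the zero components. As soon as their number
is the decoded count, the two sets are equal, and this happens after finitely many letters. -/
theorem lpoStar_le_of_finds {g : Tuples ℝ → Tuples ℝ} {dec : List Bool → Option ℕ}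
    (hdec : Primrec dec) (hg : ∀ x r, names r (g x) → Finds dec r (zeroCount x)) :
    WeihrauchLE LPO.star (MultiFun.ofFun g) := by
  classical
  let ψ : List Bool → ℕ → Option Bool := fun w j =>
    if (evensWord w).idxOf true < (evensWord w).length ∧
        dec (oddsWord w) = some (unseenCount (evensWord w)) then
      some (unseenBit (evensWord w) j) else none
  have hψ : Primrec₂ ψ := by
    have he : Primrec fun x : List Bool × ℕ => evensWord x.1 := primrec_evensWord.comp Primrec.fst
    exact Primrec.ite ((Primrec.nat_lt.comp (Primrec.list_idxOf.comp (Primrec.const true) he)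
      (Primrec.list_length.comp he)).and (Primrec.eq.comp
        (hdec.comp (primrec_oddsWord.comp Primrec.fst))
        (Primrec.option_some.comp (primrec_unseenCount.comp he))))
      (Primrec.option_some.comp (primrec_unseenBit.comp he Primrec.snd)) (Primrec.const none)
  rw [LPO_star_eq]
  refine ⟨describedFun ψ, fun p => Part.some (causal (componentwise powWord) p),
    type2Computable_describedFun hψ,
    type2Computable_causal (primrec_componentwise primrec_powWord),
    fun G hG => realizes_sandwich ?_ G hG⟩
  rintro _ ⟨n, z⟩ ⟨p, rfl, hp⟩
  dsimp only at hp
  have hz : ∀ i : Fin n, z i = fun k => p (Nat.pair i k) := fun i => (hp i).symm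
  let x : Tuples ℝ := ⟨n, fun i => powReal (z i)⟩
  refine ⟨_, Part.mem_some _, x, names_causal_componentwise ⟨p, rfl, hp⟩ ?_, fun r hr => ?_⟩
  · rintro i q rfl
    exact names_causal_powWord _
  obtain ⟨hd1, M₀, hd2⟩ := hg x r hr
  let Z : ℕ → Prop := fun i => ∀ k, p (Nat.pair i k) = false
  have hzc : zeroCount x = (Finset.univ.filter fun i : Fin n => Z i).card := by
    unfold zeroCount
    congr 1
    ext i
    rw [Finset.mem_filter, Finset.mem_filter]
    simp only [x, powReal_eq_zero_iff, hz, Z]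
  have hunseen : ∀ m, n < m → unseenCount (initialWord (tagged n p) m) =
      (Finset.univ.filter fun i : Fin n => ¬ Seen (initialWord (tagged n p) m) i).card := by
    intro m hm
    rw [unseenCount, idxOf_initialWord_tagged, Nat.min_eq_left hm.le, length_filter_range]
    simp
  have hsub : ∀ m, n < m → (Finset.univ.filter fun i : Fin n => Z i) ⊆
      Finset.univ.filter fun i : Fin n => ¬ Seen (initialWord (tagged n p) m) i := by
    intro m hm i hi
    rw [Finset.mem_filter] at hi ⊢
    refine ⟨hi.1, fun hs => ?_⟩
    obtain ⟨k, -, hk⟩ := (seen_initialWord hm).1 hs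
    rw [hi.2 k] at hk
    simp at hk
  let q : Cantor := tagged n fun a => decide (a.unpair.1 < n ∧ Z a.unpair.1)
  have hbit : ∀ m, n < m → (∀ i < n, ¬ Seen (initialWord (tagged n p) m) i ↔ Z i) →
      ∀ j, unseenBit (initialWord (tagged n p) m) j = q j := by
    intro m hm h j
    rw [unseenBit, idxOf_initialWord_tagged, Nat.min_eq_left hm.le]
    rcases lt_trichotomy j n with hlt | rfl | hgt
    · rw [if_pos hlt]
      exact (tagged_apply_of_lt _ hlt).symm
    · rw [if_neg (by omega), if_pos rfl]
      exact (tagged_apply_self _ _).symm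
    · obtain ⟨a, rfl⟩ : ∃ a, j = n + 1 + a := ⟨j - n - 1, by omega⟩
      rw [if_neg (by omega), if_neg (by omega), show n + 1 + a - n - 1 = a by omega]
      simp only [q]
      rw [tagged_apply_add, decide_eq_decide]
      exact and_congr_right fun hi => h _ hi
  refine ⟨q, ?_, _, rfl, fun i => ?_⟩
  · rw [mem_describedFun]
    intro j
    simp only [ψ, evensWord_pairing, oddsWord_pairing, length_initialWord,
      idxOf_initialWord_tagged]
    constructor
    · have hwit : ∀ i : Fin n, ∃ k, ¬ Z i → p (Nat.pair i k) = true := by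
        intro i
        by_cases h : Z i
        · exact ⟨0, fun h' => absurd h h'⟩
        · simp only [Z, not_forall, Bool.not_eq_false] at h
          obtain ⟨k, hk⟩ := h
          exact ⟨k, fun _ => hk⟩
      choose k hk using hwit
      -- Long enough for the count to be decoded, for the tag to be complete, and for a letter `1`
      -- of each nonzero component to be visible.
      set m := M₀ + n + 2 + Finset.univ.sup fun i : Fin n => Nat.pair i (k i)
      have hm : n < m := by omega
      have hall : ∀ i < n, ¬ Seen (initialWord (tagged n p) m) i ↔ Z i := by
        intro i hi
        constructor
        · intro hs
          by_contra hZ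
          refine hs ((seen_initialWord hm).2 ⟨k ⟨i, hi⟩, ?_, hk ⟨i, hi⟩ hZ⟩)
          have := Finset.le_sup (f := fun i : Fin n => Nat.pair i (k i)) (Finset.mem_univ ⟨i, hi⟩)
          simp only at this
          omega
        · intro hZ
          exact (Finset.mem_filter.1 (hsub m hm
            (Finset.mem_filter.2 ⟨Finset.mem_univ (⟨i, hi⟩ : Fin n), hZ⟩))).2
      refine ⟨2 * m, ?_⟩
      rw [Nat.mul_div_cancel_left _ two_pos, if_pos, hbit m hm hall]
      refine ⟨by omega, ?_⟩
      rw [hd2 m (by omega), hunseen m hm, hzc]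
      congr 2
      ext i
      rw [Finset.mem_filter, Finset.mem_filter, hall i i.2]
    · intro m b hb
      split_ifs at hb with h
      obtain ⟨h1, h2⟩ := h
      have hm : n < m / 2 := by omega
      have h3 := hd1 _ _ h2
      rw [hunseen _ hm, hzc] at h3
      -- Soundness: a finite set that contains the set of zero components and has no more elements
      -- is equal to it.
      have h4 := Finset.eq_of_subset_of_card_le (hsub _ hm) h3.le
      rw [← hbit _ hm (fun i hi => ?_) j]
      · simpa using hb.symm
      · have := Finset.ext_iff.1 h4 ⟨i, hi⟩
        rw [Finset.mem_filter, Finset.mem_filter] at this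
        simpa using this.symm
  · change decide ((Nat.pair i 0).unpair.1 < n ∧ Z (Nat.pair i 0).unpair.1) = _
    rw [Bool.eq_iff_iff, decide_eq_true_iff, Nat.unpair_pair]
    refine Iff.trans ?_ (lpoStar_apply_eq_true ⟨n, z⟩ i).symm
    change (i : ℕ) < n ∧ Z i ↔ ∀ k, z i k = false
    rw [hz i]
    exact and_iff_right i.2

end Backward

/-! ### Decoding the number of zeros from the output. -/

section Decoding

/-- Decodes `c` from a name of a tuple of length `c + 1`. -/
def decodeLength (o : List Bool) : Option ℕ :=
  if o.idxOf true < o.length then some (o.idxOf true - 1) else none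

theorem primrec_decodeLength : Primrec decodeLength := by
  have hn : Primrec fun o : List Bool => o.idxOf true :=
    Primrec.list_idxOf.comp (Primrec.const true) Primrec.id
  exact Primrec.ite (Primrec.nat_lt.comp hn Primrec.list_length)
    (Primrec.option_some.comp (Primrec.pred.comp hn)) (Primrec.const none)

theorem finds_decodeLength {x : Tuples ℝ} {v : ℕ → ℕ} {r : Cantor}
    (hr : names r (constTuple (fun c => c + 1) v x)) : Finds decodeLength r (zeroCount x) := by
  obtain ⟨r', hr, -⟩ := hr
  replace hr : r = tagged (zeroCount x + 1) r' := hr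
  subst hr
  simp only [Finds, decodeLength, idxOf_initialWord_tagged, length_initialWord]
  refine ⟨fun m a h => ?_, zeroCount x + 2, fun m hm => ?_⟩
  · split_ifs at h with hlt
    rw [Option.some_inj] at h
    omega
  · rw [if_pos (by omega), Option.some_inj]
    omega

/-- The integer nearest to the rational with code `t`, if this integer is not negative. -/
def nearestNat (t : ℕ) : ℕ :=
  (2 * t.unpair.1.unpair.1 + (t.unpair.2 + 1) - 2 * t.unpair.1.unpair.2) / (2 * (t.unpair.2 + 1))

theorem primrec_nearestNat : Primrec nearestNat := by
  have h1 : Primrec fun t : ℕ => t.unpair.1.unpair :=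
    Primrec.unpair.comp (Primrec.fst.comp Primrec.unpair)
  have hd : Primrec fun t : ℕ => t.unpair.2 + 1 := Primrec.succ.comp (Primrec.snd.comp Primrec.unpair)
  exact Primrec.nat_div.comp (Primrec.nat_sub.comp (Primrec.nat_add.comp
    (Primrec.nat_double.comp (Primrec.fst.comp h1)) hd)
    (Primrec.nat_double.comp (Primrec.snd.comp h1))) (Primrec.nat_double.comp hd)

/-- For the rational `q` with code `t`, the quotient in `nearestNat` is the integer part of `q + 1 /
2`, with numerator and denominator doubled; the hypothesis places it in `[c, c + 1)`. -/
theorem nearestNat_eq {c t : ℕ} (h : |(c : ℝ) - (ratEnum t : ℝ)| < 1 / 2) : nearestNat t = c := by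
  set a := t.unpair.1.unpair.1 with ha
  set b := t.unpair.1.unpair.2 with hb
  set d := t.unpair.2 with hd
  have hq : (ratEnum t : ℝ) = ((a : ℝ) - b) / (d + 1) := by
    simp [ratEnum, ← ha, ← hb, ← hd]
  rw [hq, abs_lt] at h
  obtain ⟨h1, h2⟩ := h
  have hpos : (0 : ℝ) < d + 1 := by positivity
  have e1 : ((a : ℝ) - b) < (c + 1 / 2) * (d + 1) := by
    rw [← div_lt_iff₀ hpos]
    linarith
  have e2 : ((c : ℝ) - 1 / 2) * (d + 1) < a - b := by
    rw [← lt_div_iff₀ hpos]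
    linarith
  have f1 : 2 * a < (2 * c + 1) * (d + 1) + 2 * b := by
    have : (2 * a : ℝ) < (2 * c + 1) * (d + 1) + 2 * b := by linarith
    exact_mod_cast this
  have f2 : 2 * c * (d + 1) + 2 * b < 2 * a + (d + 1) := by
    have : (2 * c * (d + 1) + 2 * b : ℝ) < 2 * a + (d + 1) := by linarith
    exact_mod_cast this
  change (2 * a + (d + 1) - 2 * b) / (2 * (d + 1)) = c
  have g1 : c * (2 * (d + 1)) = 2 * c * (d + 1) := by ring
  have g2 : (c + 1) * (2 * (d + 1)) = (2 * c + 1) * (d + 1) + (d + 1) := by ring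
  refine Nat.div_eq_of_lt_le ?_ ?_
  · omega
  · omega

/-- The beginning of length `k` of the first component of a name of a tuple of length one. -/
def firstComponent (o : List Bool) (k : ℕ) : List Bool :=
  (List.range k).map fun l => o.getD (2 + Nat.pair 0 l) false

/-- Decodes a natural number from a name of the real tuple of length one with this entry. -/
def decodeNat (o : List Bool) : Option ℕ :=
  ((List.range o.length).filterMap fun k =>
    if o.getD (2 + Nat.pair 0 k) false = true ∧ (scan (firstComponent o k)).1 = 1 then
      some (nearestNat (scan (firstComponent o k)).2) else none).head?

theorem primrec_decodeNat : Primrec decodeNat := by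
  have hf : Primrec₂ firstComponent :=
    Primrec.list_map (Primrec.list_range.comp Primrec.snd) ((Primrec.list_getD false).comp
      (Primrec.fst.comp Primrec.fst) (Primrec.nat_add.comp (Primrec.const 2)
        (Primrec₂.natPair.comp (Primrec.const 0) Primrec.snd)))
  have hs : Primrec fun x : List Bool × ℕ => scan (firstComponent x.1 x.2) := primrec_scan.comp hf
  refine Primrec.list_head?.comp (Primrec.listFilterMap
    (Primrec.list_range.comp Primrec.list_length) ?_)
  exact Primrec.ite ((Primrec.eq.comp ((Primrec.list_getD false).comp Primrec.fst
    (Primrec.nat_add.comp (Primrec.const 2) (Primrec₂.natPair.comp (Primrec.const 0) Primrec.snd)))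
    (Primrec.const true)).and (Primrec.eq.comp (Primrec.fst.comp hs) (Primrec.const 1)))
    (Primrec.option_some.comp (primrec_nearestNat.comp (Primrec.snd.comp hs))) (Primrec.const none)

/-- The rational with index `1` has error less than `1 / 2` and so determines the integer `c`. The
decoder waits for the letter that ends its block, the second one. -/
theorem finds_decodeNat {c : ℕ} {r : Cantor} (hr : names r (⟨1, fun _ => (c : ℝ)⟩ : Tuples ℝ)) :
    Finds decodeNat r c := by
  obtain ⟨r', rfl, hr'⟩ := hr
  obtain ⟨s, hs, hx⟩ := hr' (0 : Fin 1)
  have hr0 : ∀ k, r' (Nat.pair 0 k) = blocks s k := fun k => congrFun hs k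
  have hc : nearestNat (s 1) = c := nearestNat_eq (by simpa using hx 1)
  dsimp only at *
  have hmono : ∀ l k, l < k → Nat.pair 0 l < Nat.pair 0 k := fun l k h => Nat.pair_lt_pair_right _ h
  have hget : ∀ m k, 2 + Nat.pair 0 k < m →
      (initialWord (tagged 1 r') m).getD (2 + Nat.pair 0 k) false = blocks s k := by
    intro m k h
    rw [getD_initialWord _ h, show 2 + Nat.pair 0 k = 1 + 1 + Nat.pair 0 k by omega,
      tagged_apply_add, hr0]
  have hfirst : ∀ m k, 2 + Nat.pair 0 k < m →
      firstComponent (initialWord (tagged 1 r') m) k = initialWord (blocks s) k := by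
    intro m k h
    refine List.map_congr_left fun l hl => ?_
    have := hmono l k (List.mem_range.1 hl)
    exact hget m l (by omega)
  have hmem : ∀ m k a, (if (initialWord (tagged 1 r') m).getD (2 + Nat.pair 0 k) false = true ∧
        (scan (firstComponent (initialWord (tagged 1 r') m) k)).1 = 1 then
      some (nearestNat (scan (firstComponent (initialWord (tagged 1 r') m) k)).2) else none) =
        some a → a = c := by
    intro m k a h
    split_ifs at h with h1
    obtain ⟨h1, h2⟩ := h1
    -- Positions that are not yet visible read as `false` by default and cannot pass for the end of
    -- a block.
    have hlt : 2 + Nat.pair 0 k < m := by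
      by_contra hcon
      rw [List.getD_eq_default _ _ (by rw [length_initialWord]; omega)] at h1
      simp at h1
    rw [hget m k hlt] at h1
    rw [hfirst m k hlt] at h h2
    obtain ⟨j, t, ht, rfl⟩ := exists_block s k
    rw [scan_initialWord_blocks ht] at h h2
    rw [blocks_apply ht, decide_eq_true_iff] at h1
    dsimp only at h h2
    subst h2
    rw [h1, hc, Option.some_inj] at h
    exact h.symm
  have hsound : ∀ m a, decodeNat (initialWord (tagged 1 r') m) = some a → a = c := by
    intro m a h
    have := List.mem_of_mem_head? h
    rw [List.mem_filterMap] at this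
    obtain ⟨k, -, hk⟩ := this
    exact hmem m k a hk
  refine ⟨hsound, 2 + Nat.pair 0 (onePos s 1) + 1, fun m hm => ?_⟩
  have hle : onePos s 1 ≤ Nat.pair 0 (onePos s 1) := Nat.right_le_pair _ _
  have hsome : (decodeNat (initialWord (tagged 1 r') m)).isSome := by
    rw [decodeNat, List.isSome_head?]
    refine List.ne_nil_of_mem (a := c) (List.mem_filterMap.2 ⟨onePos s 1, ?_, ?_⟩)
    · rw [List.mem_range, length_initialWord]
      omega
    · rw [hget _ _ (by omega), hfirst _ _ (by omega), onePos_eq, blocks_apply le_rfl,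
        scan_initialWord_blocks le_rfl, hc]
      simp
  obtain ⟨a, ha⟩ := Option.isSome_iff_exists.1 hsome
  rw [ha, hsound m a ha]

end Decoding

theorem countZeros_equiv : WeihrauchEquiv (MultiFun.ofFun countZeros) LPO.star :=
  ⟨constTuple_le_lpoStar (Primrec.const 1) Primrec.id,
    lpoStar_le_of_finds primrec_decodeNat fun _ _ hr => finds_decodeNat hr⟩

theorem constTuple_length_equiv :
    WeihrauchEquiv (MultiFun.ofFun (constTuple (fun c => c + 1) fun _ => 0)) LPO.star :=
  ⟨constTuple_le_lpoStar Primrec.succ (Primrec.const 0),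
    lpoStar_le_of_finds primrec_decodeLength fun _ _ hr => finds_decodeLength hr⟩

/-! ### Determinism and single steps of the machines. -/

section Determinism

variable {A : Type*} {S : AlgStructure A} {P : Program S}

theorem Step.unique {c c₁ c₂ : Config A} (h₁ : Step P c c₁) (h₂ : Step P c c₂) : c₁ = c₂ := by
  unfold Step at h₁ h₂
  rcases hcmd : P[c.line]? with _ | (j | j | ⟨i, j⟩ | ⟨i, j, l⟩ | _ | o | ⟨t, l⟩ | _) <;>
    rw [hcmd] at h₁ h₂ <;> simp only at h₁ h₂
  · rw [h₁, h₂]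
  · rw [h₁, h₂]
  · rw [h₁, h₂]
  · rw [h₁, h₂]
  · rw [h₁, h₂]
  · obtain ⟨v, hv, rfl⟩ := h₁
    obtain ⟨w, hw, rfl⟩ := h₂
    rw [Part.mem_unique hv hw]
  · rcases h₁ with ⟨h, rfl⟩ | ⟨h, rfl⟩ <;> rcases h₂ with ⟨h', rfl⟩ | ⟨h', rfl⟩
    · rfl
    · exact absurd h h'
    · exact absurd h' h
    · rfl

theorem not_step_of_halt {c c' : Config A} (h : P[c.line]? = some .halt) : ¬ Step P c c' := by
  unfold Step
  rw [h]
  exact id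

theorem eq_of_halt_of_reaches {c c' : Config A} (h : P[c.line]? = some .halt)
    (hc : Relation.ReflTransGen (Step P) c c') : c = c' := by
  rcases hc.cases_head with h' | ⟨d, hd, -⟩
  · exact h'
  · exact absurd hd (not_step_of_halt h)

theorem HaltsWith.unique {a₀ : A} {x y y' : Tuples A} (h : HaltsWith P a₀ x y)
    (h' : HaltsWith P a₀ x y') : y = y' := by
  obtain ⟨c, hc, hh, rfl⟩ := h
  obtain ⟨c', hc', hh', rfl⟩ := h'
  rcases Relation.ReflTransGen.total_of_right_unique
    (show Relator.RightUnique (Step P) from fun _ _ _ h₁ h₂ => h₁.unique h₂) hc hc' with h | h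
  · rw [eq_of_halt_of_reaches hh h]
  · rw [eq_of_halt_of_reaches hh' h]

theorem machineComputable_of_haltsWith {a₀ : A} {g : Tuples A → Tuples A}
    (h : ∀ x, HaltsWith P a₀ x (g x)) : MachineComputable S a₀ (g : Tuples A →. Tuples A) := by
  refine ⟨P, fun x y => ?_⟩
  rw [PFun.coe_val, Part.mem_some_iff]
  constructor
  · rintro rfl
    exact h x
  · exact fun h' => h'.unique (h x)

theorem Config.output_eq {c : Config A} {m : ℕ} {v : A} (h : c.idx 0 = m)
    (hr : ∀ j ≤ m, c.reg j = v) : c.output = ⟨m + 1, fun _ => v⟩ := by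
  subst h
  simp only [Config.output]
  congr 1
  funext i
  exact hr i (Nat.le_of_lt_succ i.2)

end Determinism

section Steps

variable {C : Set ℝ} {P : Program (realRing C)} {l i j t : ℕ} {a : ℕ → ℕ} {r : ℕ → ℝ}

theorem step_zero (h : P[l]? = some (.zero j)) :
    Step P ⟨l, a, r⟩ ⟨l + 1, Function.update a j 0, r⟩ := by simp [Step, h]

theorem step_succ (h : P[l]? = some (.succ j)) :
    Step P ⟨l, a, r⟩ ⟨l + 1, Function.update a j (a j + 1), r⟩ := by simp [Step, h]

theorem step_move (h : P[l]? = some (.move i j)) :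
    Step P ⟨l, a, r⟩ ⟨l + 1, Function.update a j (a i), r⟩ := by simp [Step, h]

theorem step_jump (h : P[l]? = some (.jumpEq i j t)) (ha : a i = a j) :
    Step P ⟨l, a, r⟩ ⟨t, a, r⟩ := by simp [Step, h, ha]

theorem step_noJump (h : P[l]? = some (.jumpEq i j t)) (ha : a i ≠ a j) :
    Step P ⟨l, a, r⟩ ⟨l + 1, a, r⟩ := by simp [Step, h, ha]

theorem step_copy (h : P[l]? = some .copy) :
    Step P ⟨l, a, r⟩ ⟨l + 1, a, Function.update r (a 0) (r (a 1))⟩ := by simp [Step, h]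

theorem step_add (h : P[l]? = some (.apply RingOp.add)) :
    Step P ⟨l, a, r⟩ ⟨l + 1, a, Function.update r 0 (r 1 + r 2)⟩ := by
  simp only [Step, h]
  exact ⟨_, Part.mem_some _, by simp [RingOp.eval]⟩

theorem step_const {c : C} (h : P[l]? = some (.apply (RingOp.const c))) :
    Step P ⟨l, a, r⟩ ⟨l + 1, a, Function.update r 0 (c : ℝ)⟩ := by
  simp only [Step, h]
  exact ⟨_, Part.mem_some _, by simp [RingOp.eval]⟩

theorem step_branch (h : P[l]? = some (.branch () t)) (hr : r 1 = r 2) :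
    Step P ⟨l, a, r⟩ ⟨t, a, r⟩ := by
  simp only [Step, h]
  exact Or.inl ⟨hr, trivial⟩

theorem step_noBranch (h : P[l]? = some (.branch () t)) (hr : r 1 ≠ r 2) :
    Step P ⟨l, a, r⟩ ⟨l + 1, a, r⟩ := by
  simp only [Step, h]
  exact Or.inr ⟨hr, trivial⟩

end Steps

/-! ### Programs that count zeros. -/

open Relation.ReflTransGen (head refl)

/-- The common part of the programs. It copies the registers `1, 2` to `n + 3, n + 4`, and then
counts the zeros in the registers `3, …, n + 4`; among these are two more zeros than in the input,
and the index register `7` holds the number of zeros minus two. -/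
def countProgram (C : Set ℝ) : Program (realRing C) :=
  -- Comparisons see only the registers `1, 2`, so the inputs there are moved away; the targets `n +
  -- 3, n + 4` cannot collide with them even for `n = 0`. The registers `n + 1, n + 2`, which hold
  -- `0`, produce the two surplus zeros. As index registers cannot be decremented, `I 6` and `I 7`
  -- trail behind the counter `I 5` by one and two. Register `2` receives a zero from register `0`,
  -- so no constant is needed.
  [.succ 0, .succ 0, .succ 0, .succ 1, .copy, .succ 0, .succ 1, .copy, .move 0 3, .move 1 2,
    .move 1 0, .move 4 1, .copy,
    .jumpEq 2 3 25, .succ 2, .zero 0, .succ 0, .move 2 1, .copy, .branch () 21, .jumpEq 0 0 13,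
    .move 6 7, .move 5 6, .succ 5, .jumpEq 0 0 13]

open Classical in
noncomputable def zerosBelow (y : ℕ → ℝ) (m : ℕ) : ℕ :=
  ∑ j ∈ Finset.range m, if y (j + 3) = 0 then 1 else 0

/-- Both sides count the zeros in the start registers `1, …, n + 2`: the left side because the
scanned registers are a rearrangement of these, the right side because the last two hold `0`. -/
theorem zerosBelow_eq {n : ℕ} (x : Fin n → ℝ) {y : ℕ → ℝ} {r : ℕ → ℝ}
    (hr : r = (Config.start 0 (⟨n, x⟩ : Tuples ℝ)).reg) (h1 : y (n + 3) = r 1) (h2 : y (n + 4) = r 2)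
    (hy : ∀ j < n, y (j + 3) = r (j + 3)) : zerosBelow y (n + 2) = zeroCount ⟨n, x⟩ + 2 := by
  classical
  set e : ℕ → ℕ := fun j => if r j = 0 then 1 else 0 with he
  have hL : zerosBelow y (n + 2) = (∑ j ∈ Finset.range n, e (j + 3)) + e 1 + e 2 := by
    rw [zerosBelow, Finset.sum_range_succ, Finset.sum_range_succ]
    simp only [he]
    rw [show n + 1 + 3 = n + 4 by omega, h1, h2]
    congr 2
    exact Finset.sum_congr rfl fun j hj => by rw [hy j (Finset.mem_range.1 hj)]
  have hM : ∑ j ∈ Finset.range (n + 2), e (j + 1) =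
      (∑ j ∈ Finset.range n, e (j + 3)) + e 2 + e 1 := by
    rw [Finset.sum_range_succ', Finset.sum_range_succ']
  have hpad : ∀ j, n < j → e j = 1 := by
    intro j hj
    have : r j = 0 := by
      rw [hr]
      simp only [Config.start]
      rw [dif_neg (by omega)]
    simp [he, this]
  have hR : ∑ j ∈ Finset.range (n + 2), e (j + 1) = (∑ j ∈ Finset.range n, e (j + 1)) + 2 := by
    rw [Finset.sum_range_succ, Finset.sum_range_succ, hpad _ (by omega), hpad _ (by omega)]
  have hz : zeroCount ⟨n, x⟩ = ∑ j ∈ Finset.range n, e (j + 1) := by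
    rw [zeroCount, Finset.card_filter, Finset.sum_range]
    refine Finset.sum_congr rfl fun i _ => ?_
    have : r (i + 1) = x i := by
      rw [hr]
      simp only [Config.start]
      rw [dif_pos ⟨by omega, i.2⟩]
      congr 1
    simp only [he, this]
  omega

section Counting

variable {C : Set ℝ} (tail : Program (realRing C))

/-- The state of the counting loop after `m` rounds. -/
structure CountState (n : ℕ) (y : ℕ → ℝ) (m : ℕ) (c : Config ℝ) : Prop where
  line : c.line = 13
  idx2 : c.idx 2 = m + 2
  idx3 : c.idx 3 = n + 4
  idx5 : c.idx 5 = zerosBelow y m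
  -- Truncated subtraction is exact here and in the next field: the trailing registers stay at their
  -- initial `0` until the counter has passed `1` and `2`.
  idx6 : c.idx 6 = zerosBelow y m - 1
  idx7 : c.idx 7 = zerosBelow y m - 2
  idx8 : c.idx 8 = 0
  reg0 : c.reg 0 = 0
  reg2 : c.reg 2 = 0
  reg : ∀ j, c.reg (j + 3) = y (j + 3)

theorem CountState.next {n m : ℕ} {y : ℕ → ℝ} {c : Config ℝ} (h : CountState n y m c)
    (hm : m < n + 2) : ∃ c', Relation.ReflTransGen (Step (countProgram C ++ tail)) c c' ∧
      CountState n y (m + 1) c' := by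
  obtain ⟨l, a, r⟩ := c
  obtain ⟨hl, h2, h3, h5, h6, h7, h8, hr0, hr2, hr⟩ := h
  dsimp only at *
  subst hl
  have hne : a 2 ≠ a 3 := by omega
  have hz : zerosBelow y (m + 1) = zerosBelow y m + if y (m + 3) = 0 then 1 else 0 := by
    rw [zerosBelow, Finset.sum_range_succ]
    rfl
  by_cases hy : y (m + 3) = 0
  · refine ⟨_, head (step_noJump rfl hne) <| head (step_succ rfl) <| head (step_zero rfl) <|
      head (step_succ rfl) <| head (step_move rfl) <| head (step_copy rfl) <|
      head (step_branch rfl ?_) <| head (step_move rfl) <| head (step_move rfl) <|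
      head (step_succ rfl) <| head (step_jump rfl rfl) refl, ?_⟩
    · simp [h2, hr2, hr m, hy]
    · rw [if_pos hy] at hz
      constructor <;> simp [h2, h3, h5, h6, h8, hr0, hr2, hr, hz]
  · refine ⟨_, head (step_noJump rfl hne) <| head (step_succ rfl) <| head (step_zero rfl) <|
      head (step_succ rfl) <| head (step_move rfl) <| head (step_copy rfl) <|
      head (step_noBranch rfl ?_) <| head (step_jump rfl rfl) refl, ?_⟩
    · simp [h2, hr2, hr m, hy]
    · rw [if_neg hy] at hz
      constructor <;> simp [h2, h3, h5, h6, h7, h8, hr0, hr2, hr, hz]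

theorem exists_countState {n : ℕ} {y : ℕ → ℝ} {c : Config ℝ} (h : CountState n y 0 c) {m : ℕ}
    (hm : m ≤ n + 2) : ∃ c', Relation.ReflTransGen (Step (countProgram C ++ tail)) c c' ∧
      CountState n y m c' := by
  induction m with
  | zero => exact ⟨c, refl, h⟩
  | succ m ih =>
    obtain ⟨c', hc', h'⟩ := ih (by omega)
    obtain ⟨c'', hc'', h''⟩ := h'.next tail (by omega)
    exact ⟨c'', hc'.trans hc'', h''⟩

theorem reaches_count (x : Tuples ℝ) : ∃ a r,
    Relation.ReflTransGen (Step (countProgram C ++ tail)) (Config.start 0 x) ⟨25, a, r⟩ ∧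
      a 7 = zeroCount x ∧ a 8 = 0 ∧ r 0 = 0 := by
  obtain ⟨n, x⟩ := x
  set r₀ := (Config.start 0 (⟨n, x⟩ : Tuples ℝ)).reg with hr₀
  have hr00 : r₀ 0 = 0 := by simp [hr₀, Config.start]
  have hstart : Config.start 0 (⟨n, x⟩ : Tuples ℝ) = ⟨0, fun j => if j = 0 then n else 0, r₀⟩ := rfl
  let y : ℕ → ℝ := Function.update (Function.update r₀ (n + 3) (r₀ 1)) (n + 4) (r₀ 2)
  obtain ⟨c₀, h₀, hc₀⟩ : ∃ c, Relation.ReflTransGen (Step (countProgram C ++ tail))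
      (Config.start 0 (⟨n, x⟩ : Tuples ℝ)) c ∧ CountState n y 0 c := by
    rw [hstart]
    refine ⟨_, head (step_succ rfl) <| head (step_succ rfl) <| head (step_succ rfl) <|
      head (step_succ rfl) <| head (step_copy rfl) <| head (step_succ rfl) <|
      head (step_succ rfl) <| head (step_copy rfl) <| head (step_move rfl) <|
      head (step_move rfl) <| head (step_move rfl) <| head (step_move rfl) <|
      head (step_copy rfl) refl, ?_⟩
    constructor <;> simp [Function.update_apply, zerosBelow, hr00, y]
  obtain ⟨c₁, h₁, hc₁⟩ := exists_countState tail hc₀ (le_refl (n + 2))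
  have hz : zerosBelow y (n + 2) = zeroCount ⟨n, x⟩ + 2 := by
    refine zerosBelow_eq x hr₀ ?_ ?_ fun j hj => ?_
    · simp [y]
    · simp [y]
    · simp [y, show j ≠ n by omega, show j ≠ n + 1 by omega]
  obtain ⟨l, a, r⟩ := c₁
  obtain ⟨hl, h2, h3, h5, h6, h7, h8, hr0, hr2, hr⟩ := hc₁
  dsimp only at *
  subst hl
  refine ⟨a, r, (h₀.trans h₁).tail (step_jump rfl (by omega)), by omega, h8, hr0⟩

end Counting

/-- After counting: the registers up to the number of zeros are set to `0`. -/
def lengthProgram : Program (realRing ∅) :=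
  countProgram ∅ ++ [.zero 0, .zero 1, .jumpEq 0 7 31, .succ 0, .copy, .jumpEq 0 0 27, .halt]

theorem lengthProgram_haltsWith (x : Tuples ℝ) :
    HaltsWith lengthProgram 0 x (constTuple (fun c => c + 1) (fun _ => 0) x) := by
  obtain ⟨a, r, h, h7, -, hr⟩ := reaches_count (C := ∅)
    [.zero 0, .zero 1, .jumpEq 0 7 31, .succ 0, .copy, .jumpEq 0 0 27, .halt] x
  -- The output of a machine has length `I 0 + 1`, so raising `I 0` to the count, with zeros written
  -- on the way, gives length count plus one.
  have key : ∀ m ≤ zeroCount x, ∃ a r, Relation.ReflTransGen (Step lengthProgram)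
      (Config.start 0 x) ⟨27, a, r⟩ ∧ a 0 = m ∧ a 1 = 0 ∧ a 7 = zeroCount x ∧ ∀ j ≤ m, r j = 0 := by
    intro m
    induction m with
    | zero =>
      refine fun _ => ⟨_, _, h.trans <| head (step_zero rfl) <| head (step_zero rfl) refl, ?_⟩
      simp [h7, hr]
    | succ m ih =>
      intro hm
      obtain ⟨a, r, h, h0, h1, h7, hr⟩ := ih (by omega)
      refine ⟨_, _, h.trans <| head (step_noJump rfl (by omega)) <| head (step_succ rfl) <|
        head (step_copy rfl) <| head (step_jump rfl rfl) refl, ?_⟩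
      simp only [Function.update_apply, h0, h1, h7]
      refine ⟨by simp, by simp, by simp, fun j hj => ?_⟩
      by_cases hjm : j = m + 1
      · simp [hjm, hr]
      · simp [hjm, hr j (by omega)]
  obtain ⟨a, r, h, h0, -, h7, hr⟩ := key _ le_rfl
  refine ⟨⟨31, a, r⟩, h.tail (step_jump rfl (by rw [h0, h7])), rfl, ?_⟩
  rw [Config.output_eq h0 hr]
  simp [constTuple]

/-- After counting: the number of zeros is written down as a sum of ones. -/
def numberTail : Program (realRing {1}) :=
  [.zero 0, .succ 0, .zero 1, .copy, .apply (RingOp.const ⟨1, rfl⟩), .succ 0, .copy, .zero 0,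
    .succ 0, .jumpEq 8 7 39, .apply RingOp.add, .copy, .succ 8, .jumpEq 0 0 34,
    .zero 0, .succ 1, .copy, .halt]

theorem numberProgram_haltsWith (x : Tuples ℝ) :
    HaltsWith (countProgram {1} ++ numberTail) 0 x (countZeros x) := by
  obtain ⟨a, r, h, h7, h8, hr⟩ := reaches_count (C := {1}) numberTail x
  -- Loop invariant: `I 8` counts the rounds, register `1` holds the partial sum and register `2`
  -- the summand `1`.
  have key : ∀ m ≤ zeroCount x, ∃ a r, Relation.ReflTransGen (Step (countProgram {1} ++ numberTail))
      (Config.start 0 x) ⟨34, a, r⟩ ∧ a 0 = 1 ∧ a 1 = 0 ∧ a 7 = zeroCount x ∧ a 8 = m ∧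
        r 1 = m ∧ r 2 = 1 := by
    intro m
    induction m with
    | zero =>
      refine fun _ => ⟨_, _, h.trans <| head (step_zero rfl) <| head (step_succ rfl) <|
        head (step_zero rfl) <| head (step_copy rfl) <| head (step_const rfl) <|
        head (step_succ rfl) <| head (step_copy rfl) <| head (step_zero rfl) <|
        head (step_succ rfl) refl, ?_⟩
      simp [h7, h8, hr]
    | succ m ih =>
      intro hm
      obtain ⟨a, r, h, h0, h1, h7, h8, hr1, hr2⟩ := ih (by omega)
      refine ⟨_, _, h.trans <| head (step_noJump rfl (by omega)) <| head (step_add rfl) <|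
        head (step_copy rfl) <| head (step_succ rfl) <| head (step_jump rfl rfl) refl, ?_⟩
      simp [h0, h1, h7, h8, hr1, hr2]
  obtain ⟨a, r, h, h0, h1, h7, h8, hr1, -⟩ := key _ le_rfl
  refine ⟨_, h.trans <| head (step_jump rfl (by rw [h7, h8])) <| head (step_zero rfl) <|
    head (step_succ rfl) <| head (step_copy rfl) refl, rfl, ?_⟩
  -- A tuple of length one corresponds to `I 0 = 0` at the halt.
  refine Config.output_eq (m := 0) (by simp) fun j hj => ?_
  obtain rfl : j = 0 := by omega
  simp [h1, hr1]

end AlgWeihrauch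

theorem mainTheorem6 :
    -- upper bound, with arbitrary real constants and any initial register content
    (∀ (a₀ : ℝ) (f : Tuples ℝ → Tuples ℝ),
      MachineComputable (realRing Set.univ) a₀ (f : Tuples ℝ →. Tuples ℝ) →
        ContWeihrauchLE (MultiFun.ofFun f) LPO.star) ∧
    -- the bound is attained, without any constants
    (∃ g : Tuples ℝ → Tuples ℝ,
      MachineComputable (realRing ∅) 0 (g : Tuples ℝ →. Tuples ℝ) ∧
        WeihrauchEquiv (MultiFun.ofFun g) LPO.star) ∧
    -- counting zero entries, with the constant `1` for writing down the number
    (MachineComputable (realRing {1}) 0 (countZeros : Tuples ℝ →. Tuples ℝ) ∧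
      WeihrauchEquiv (MultiFun.ofFun countZeros) LPO.star) :=
  ⟨fun _ _ hf => contWeihrauchLE_of_continuousPieces (continuousPieces_of_machineComputable hf),
    ⟨_, machineComputable_of_haltsWith lengthProgram_haltsWith, constTuple_length_equiv⟩,
    machineComputable_of_haltsWith numberProgram_haltsWith, countZeros_equiv⟩
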